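/- Notation. $\varphi$ is Euler's function, $\psi(n)=n\prod_{p\mid n}(1+1/p)$, and $\delta_n(a,b)$ is $1$ if $a\equiv b \pmod n$ and $0$ otherwise. For $D<0$ with $D\equiv 0,1\pmod 4$ let $h(D)$ be the class number of the quadratic order of discriminant $D$; put $h_w(-3)=h(-3)/3$, $h_w(-4)=h(-4)/2$, $h_w(D)=h(D)$ for all other such $D$, and $h_w(D)=0$ for every other integer $D$. For an integer $D\neq 0$ let $H(D)=\sum_{m\ge 1,\ m^2\mid D}h_w(D/m^2)$, and let $H(x)=0$ if $x$ is not an integer. Let $\ell$ be a prime, $q$ a positive integer with $\ell\nmid q$, $0\le\alpha\le\beta\le\gamma$ integers, and $d\in(\mathbb Z/\ell^\gamma\mathbb Z)^\times$ such that $(d^2q-1,\ell^\gamma)=\ell^\beta$. Let $t\in\mathbb Z$ with $t^2<4q$ and $\Delta=t^2-4q$. For $m\ge1$ let $W_m(d)$ be the number of $c\in(\mathbb Z/\ell^{\alpha+\gamma}\mathbb Z)^\times$ that lift to a solution of $x^2-tx+q\equiv 0 \pmod{\ell^{\alpha+\gamma}\,(\ell^{\alpha+\gamma},m)}$ and satisfy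 $c\equiv d^{-1}\pmod{\ell^\gamma}$, and define $$C(t,q,d)=\sum_{m\ge 1,\ m^2\mid\Delta}h_w\!\left(\frac{\Delta}{m^2}\right)\frac{\psi(\ell^{\alpha+\gamma})}{\psi(\ell^{\alpha+\gamma-\min(v_\ell(m),\alpha+\gamma)})}\,W_m(d).$$ For $0\le f\le\gamma$ define $$H_{\ell^\gamma,\ell^f}(t,q,d)=\tfrac12 H\!\left(\frac{\Delta}{\ell^{2f}}\right)\delta_{\ell^f}(d^2q,1)\,D(t;\ell^{\gamma+f})-\sum_{k=1}^{\gamma-f-1}\tfrac12 H\!\left(\frac{\Delta}{\ell^{2(f+k)}}\right)\delta_{\ell^{f+k}}(d^2q,1)\bigl(D(t;\ell^{\gamma+f+k-1})-D(t;\ell^{\gamma+f+k})\bigr),$$ where $D(t;n)=\delta_n(dq+d^{-1},t)$. Here $dq+d^{-1}$ is computed modulo $n$ from any lift of $d$ to a unit modulo $n$; the result does not depend on the lift wherever the accompanying factor $\delta_{\ell^{f}}(d^2q,1)$ or $\delta_{\ell^{f+k}}(d^2q,1)$ is nonzero, and a term in which that factor is zero is read as $0$. Then $$C(t,q,d)=2\,\frac{\psi(\ell^{2\gamma})}{\psi(\ell^{2\gamma-2\alpha})}\sum_{j=0}^{\beta-\alpha}\frac{\varphi(\ell^{2j})\,\varphi(\ell^{\gamma-\alpha-j})}{\varphi(\ell^{\gamma-\alpha})}\,H_{\ell^\gamma,\ell^{\alpha+j}}(t,q,d).$$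 -/

import Mathlib

noncomputable section

namespace EllipticTerm

/-- `ψ(n) = n ∏_{p ∣ n} (1 + 1/p)`, the index of `Γ₀(n)` in `SL₂(ℤ)`. -/
def psi (n : ℕ) : ℚ := (n : ℚ) * ∏ p ∈ n.primeFactors, (1 + 1 / (p : ℚ))

/-- For `D < 0` with `D ≡ 0, 1 (mod 4)`: the quadratic order `ℤ[(D + √D)/2]` of discriminant `D`,
as a subring of `ℂ` (so `√D = i √|D|`). -/
def quadOrder (D : ℤ) : Subalgebra ℤ ℂ :=
  Algebra.adjoin ℤ {((D : ℂ) + Complex.I * (Real.sqrt (-(D : ℝ)) : ℂ)) / 2}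

/-- The class number `h(D)`: the order of the group of invertible fractional ideals of the quadratic
order of discriminant `D` modulo principal ones. -/
def classNumber (D : ℤ) : ℕ := Nat.card (ClassGroup (quadOrder D))

/-- The weighted class number `h_w(D)`. -/
def hw (D : ℤ) : ℚ :=
  if D = -3 then (classNumber D : ℚ) / 3
  else if D = -4 then (classNumber D : ℚ) / 2
  else if D < 0 ∧ (D % 4 = 0 ∨ D % 4 = 1) then (classNumber D : ℚ)
  else 0

/-- The positive integers `m` with `m² ∣ D`, for `D ≠ 0`. -/
def sqDivisors (D : ℤ) : Finset ℕ :=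
  (Finset.Icc 1 D.natAbs).filter (fun m => ((m : ℤ) ^ 2 ∣ D))

/-- The Hurwitz-Kronecker class number `H(D) = ∑_{m² ∣ D} h_w(D / m²)`, for `D ≠ 0`. -/
def hurwitz (D : ℤ) : ℚ := ∑ m ∈ sqDivisors D, hw (D / (m : ℤ) ^ 2)

/-- `H(D / n²)`, read as `0` when `D / n²` is not an integer. -/
def hurwitzDiv (D : ℤ) (n : ℕ) : ℚ :=
  if (n : ℤ) ^ 2 ∣ D then hurwitz (D / (n : ℤ) ^ 2) else 0

/-- The set of `c ∈ (ℤ/ℓ^(α+γ))ˣ` which lift to solutions of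
`x² - t x + q ≡ 0` modulo `ℓ^(α+γ) · (ℓ^(α+γ), m)` and satisfy `c ≡ d⁻¹ (mod ℓ^γ)`. -/
def rootSet (l α γ : ℕ) (t : ℤ) (q : ℕ) (d : (ZMod (l ^ γ))ˣ) (m : ℕ) :
    Set (ZMod (l ^ (α + γ)))ˣ :=
  {c | (∃ x : ℤ, (x : ZMod (l ^ (α + γ))) = (c : ZMod (l ^ (α + γ))) ∧
          (((l ^ (α + γ) * Nat.gcd (l ^ (α + γ)) m : ℕ) : ℤ) ∣ x ^ 2 - t * x + q)) ∧
        ZMod.unitsMap (pow_dvd_pow l (Nat.le_add_left γ α)) c = d⁻¹}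

/-- The root count `W(d)`, which also depends on `m`. -/
def rootCount (l α γ : ℕ) (t : ℤ) (q : ℕ) (d : (ZMod (l ^ γ))ˣ) (m : ℕ) : ℕ :=
  (rootSet l α γ t q d m).ncard

/-- `C(t,q,d) = ∑_{m² ∣ Δ} h_w(Δ/m²) · ψ(ℓ^(α+γ)) / ψ(ℓ^(α+γ-min(κ,α+γ))) · W(d)`, where
`Δ = t² - 4q` and `κ = v_ℓ(m)`. -/
def ellipticC (l α γ : ℕ) (t : ℤ) (q : ℕ) (d : (ZMod (l ^ γ))ˣ) : ℚ :=
  ∑ m ∈ sqDivisors (t ^ 2 - 4 * q),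
    hw ((t ^ 2 - 4 * q) / (m : ℤ) ^ 2) *
      (psi (l ^ (α + γ)) / psi (l ^ (α + γ - min (padicValNat l m) (α + γ)))) *
      (rootCount l α γ t q d m : ℚ)

open Classical in
/-- `δ_{ℓ^i}(d² q, 1)` for `d ∈ (ℤ/ℓ^e)ˣ` and `i ≤ e`. -/
def deltaSq (l e : ℕ) (q : ℕ) (d : (ZMod (l ^ e))ˣ) (i : ℕ) : ℚ :=
  if l ^ i ∣ ((d : ZMod (l ^ e)) ^ 2 * (q : ZMod (l ^ e)) - 1).val then 1 else 0

open Classical in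
/-- `D(t; ℓ^i) = δ_{ℓ^i}(d q + d⁻¹, t)` for `d ∈ (ℤ/ℓ^e)ˣ`: here `a` is an integer lift of `d`, and
`b` is an inverse of `a` modulo `ℓ^i`.  By `deltaTrace_wellDefined` the residue class of `a q + b`
modulo `ℓ^i` does not depend on the lifts when `d² q ≡ 1 (mod ℓ^B)`, `B ≤ e` and `i ≤ e + B`. -/
def deltaTrace (l e : ℕ) (q : ℕ) (d : (ZMod (l ^ e))ˣ) (t : ℤ) (i : ℕ) : ℚ :=
  if ∃ a b : ℤ, (a : ZMod (l ^ e)) = (d : ZMod (l ^ e)) ∧ ((l : ℤ) ^ i ∣ a * b - 1) ∧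
      ((l : ℤ) ^ i ∣ a * q + b - t) then 1 else 0

/-- The class numbers `H_{ℓ^e, ℓ^f}(t,q,d)` for `f ≤ e` and `d ∈ (ℤ/ℓ^e)ˣ`. -/
def classH (l e f : ℕ) (t : ℤ) (q : ℕ) (d : (ZMod (l ^ e))ˣ) : ℚ :=
  1 / 2 * hurwitzDiv (t ^ 2 - 4 * q) (l ^ f) * deltaSq l e q d f * deltaTrace l e q d t (e + f)
  - ∑ k ∈ Finset.Icc 1 (e - f - 1),
      1 / 2 * hurwitzDiv (t ^ 2 - 4 * q) (l ^ (f + k)) * deltaSq l e q d (f + k) *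
        (deltaTrace l e q d t (e + f + k - 1) - deltaTrace l e q d t (e + f + k))

/-- The residue class `d q + d⁻¹` modulo `ℓ^i` is independent of the chosen lifts. -/
theorem deltaTrace_wellDefined {l e B i : ℕ} {q : ℕ} {a b a' b' : ℤ}
    (hBe : B ≤ e) (hei : e ≤ i) (hi : i ≤ e + B)
    (haa : (l : ℤ) ^ e ∣ a - a') (hB : (l : ℤ) ^ B ∣ a ^ 2 * q - 1)
    (hab : (l : ℤ) ^ i ∣ a * b - 1) (hab' : (l : ℤ) ^ i ∣ a' * b' - 1) :
    (l : ℤ) ^ i ∣ (a * q + b) - (a' * q + b') := by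
  have hBi : (l : ℤ) ^ B ∣ (l : ℤ) ^ i := pow_dvd_pow _ (hBe.trans hei)
  have hBe' : (l : ℤ) ^ B ∣ (l : ℤ) ^ e := pow_dvd_pow _ hBe
  have h1 : (l : ℤ) ^ B ∣ q - b * b' := by
    obtain ⟨u, hu⟩ := hBi.trans hab
    obtain ⟨v, hv⟩ := hBi.trans hab'
    obtain ⟨w, hw⟩ := hBe'.trans haa
    obtain ⟨z, hz⟩ := hB
    refine ⟨b ^ 2 * z - q * (a * b + 1) * u + b * b' * u - b ^ 2 * v - b ^ 2 * b' * w, ?_⟩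
    linear_combination b ^ 2 * hz - q * (a * b + 1) * hu + b * b' * hu - b ^ 2 * hv
      - b ^ 2 * b' * hw
  have h2 : (l : ℤ) ^ i ∣ (a - a') * (q - b * b') :=
    (pow_dvd_pow _ hi).trans (by rw [pow_add]; exact mul_dvd_mul haa h1)
  obtain ⟨u, hu⟩ := hab
  obtain ⟨v, hv⟩ := hab'
  obtain ⟨w, hw⟩ := h2
  refine ⟨w + b' * u - b * v, ?_⟩
  linear_combination hw + b' * hu - b * hv

end EllipticTerm

end

/-! Put F(x) = x² - t x + q and T_κ = H(Δ/ℓ^(2κ)), and let b be an integer lift of d⁻¹. Both sides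
are linear combinations of the T_κ whose coefficients depend only on the ℓ-adic behaviour of F near
b.

On the left, the m with v_ℓ(m) = κ contribute T_κ - T_(κ+1) (`sum_sqDivisors_mul`), and the roots
are counted by the y modulo ℓ^α for which F(b + ℓ^γ y) = F(b) + ℓ^γ F'(b) y + ℓ^(2γ) y² is divisible
by ℓ^(α+γ+κ) (`ellipticC_eq`). On the right, the sum defining `classH` collapses to T_f or to a
difference T_f - T_e (`classH_eq`), and the φ-weights are summed by parts (`sum_weight`).

The arithmetic input is h_w(ℓ²D) = (ℓ + 1 - n) h_w(D), where n is the number of roots modulo ℓ of a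
quadratic polynomial of discriminant D (`hw_sq_mul`). It comes from the kernel of Pic A → Pic B for
an order B and A = ℤ + ℓB. Consequently T_κ - T_(κ+1) is a geometric progression as long as Δ stays
divisible by the relevant powers of ℓ² (`hurwitzPow_sub_of_lt`).

Since b F'(b) = F(b) + (b² - q), the hypothesis on d controls the valuation of F'(b), and four cases
remain. If ℓ^(γ+α) does not divide F(b), both sides vanish. If F(b) has valuation γ + e with α ≤ e <
β, then F has constant valuation on b + ℓ^γ ℤ, and n = 1 for Δ/ℓ^(2e) (`rootSum_of_lt`). If ℓ^(γ+β)
divides F(b) and β < γ, then F'(b) has valuation exactly β, the counting is linear, and n = 2 for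
Δ/ℓ^(2β) (`rootSum_of_simple`). If β = γ, what is left is an arbitrary quadratic y² + u y + w,
treated by `localIdentity`, an induction that rescales a double root (`rootSum_of_top`). -/

/-! ### Invertible submodules of an order over a suborder of index ℓ. -/

namespace EllipticTerm

/-- `B = ℤ[ω]` with `ω² = p ω - r`, and the image of `A` in `B` is the suborder `ℤ + ℓ B`. -/
structure IsSuborder (A : Type*) {B : Type*} [CommRing A] [CommRing B] [Algebra A B]
    (l : ℕ) (ω : B) (p r : ℤ) : Prop where
  exists_rep : ∀ b : B, ∃ x y : ℤ, b = x + y * ω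
  rep_zero : ∀ x y : ℤ, (x : B) + y * ω = 0 → x = 0 ∧ y = 0
  sq : ω * ω = p * ω - r
  mem_range : ∀ x y : ℤ, (∃ a : A, algebraMap A B a = x + y * ω) ↔ (l : ℤ) ∣ y

/-- The number of roots of `s² - p s + r` modulo `ℓ`. -/
noncomputable def nroots (l : ℕ) (p r : ℤ) : ℕ := Nat.card {s : ZMod l // s ^ 2 - p * s + r = 0}

namespace IsSuborder

variable {A B : Type*} [CommRing A] [CommRing B] [Algebra A B] {l : ℕ} {ω : B} {p r : ℤ}

/-- The conductor `ℓ B`, as an `A`-module. -/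
def cond (A B : Type*) [CommRing A] [CommRing B] [Algebra A B] (l : ℕ) : Submodule A B :=
  (Ideal.span {(l : B)}).restrictScalars A

/-- The `A`-module `A u + ℓ B`. -/
def line (A : Type*) {B : Type*} [CommRing A] [CommRing B] [Algebra A B] (l : ℕ) (u : B) :
    Submodule A B :=
  Submodule.span A {u} ⊔ cond A B l

lemma mem_cond {b : B} : b ∈ cond A B l ↔ ∃ c, b = l * c := by
  simp only [cond, Submodule.restrictScalars_mem, Ideal.mem_span_singleton]; rfl

lemma mul_mem_cond (b : B) : (l : B) * b ∈ cond A B l := mem_cond.2 ⟨b, rfl⟩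

lemma cond_le_line (u : B) : cond A B l ≤ line A l u := le_sup_right

lemma self_mem_line (u : B) : u ∈ line A l u :=
  Submodule.mem_sup_left (Submodule.mem_span_singleton_self u)

lemma rep_mem_cond (h : IsSuborder A l ω p r) {x y : ℤ} :
    (x : B) + y * ω ∈ cond A B l ↔ (l : ℤ) ∣ x ∧ (l : ℤ) ∣ y := by
  rw [mem_cond]
  constructor
  · rintro ⟨c, hc⟩
    obtain ⟨x', y', rfl⟩ := h.exists_rep c
    obtain ⟨h1, h2⟩ := h.rep_zero (x - l * x') (y - l * y') (by
      push_cast; linear_combination hc)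
    exact ⟨⟨x', by linarith⟩, ⟨y', by linarith⟩⟩
  · rintro ⟨⟨x', rfl⟩, ⟨y', rfl⟩⟩
    exact ⟨x' + y' * ω, by push_cast; ring⟩

lemma exists_int_smul (h : IsSuborder A l ω p r) (a : A) :
    ∃ (k : ℤ) (c : B), algebraMap A B a = k + l * c := by
  obtain ⟨x, y, hxy⟩ := h.exists_rep (algebraMap A B a)
  obtain ⟨z, rfl⟩ := (h.mem_range x y).1 ⟨a, hxy⟩
  exact ⟨x, z * ω, by rw [hxy]; push_cast; ring⟩

lemma mem_line (h : IsSuborder A l ω p r) {u b : B} :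
    b ∈ line A l u ↔ ∃ (k : ℤ) (c : B), b = k * u + l * c := by
  rw [line, Submodule.mem_sup]
  constructor
  · rintro ⟨y, hy, z, hz, rfl⟩
    obtain ⟨a, rfl⟩ := Submodule.mem_span_singleton.1 hy
    obtain ⟨c, rfl⟩ := mem_cond.1 hz
    obtain ⟨k, d, hk⟩ := h.exists_int_smul a
    exact ⟨k, d * u + c, by rw [Algebra.smul_def, hk]; ring⟩
  · rintro ⟨k, c, rfl⟩
    exact ⟨k * u, Submodule.mem_span_singleton.2 ⟨(k : A), by simp [Algebra.smul_def]⟩,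
      l * c, mul_mem_cond c, rfl⟩

lemma mem_one (h : IsSuborder A l ω p r) {b : B} :
    b ∈ (1 : Submodule A B) ↔ ∃ (k : ℤ) (c : B), b = k + l * c := by
  rw [Submodule.mem_one]
  constructor
  · rintro ⟨a, rfl⟩; exact h.exists_int_smul a
  · rintro ⟨k, c, rfl⟩
    obtain ⟨x, y, rfl⟩ := h.exists_rep c
    obtain ⟨a, ha⟩ := (h.mem_range (k + l * x) (l * y)).2 (dvd_mul_right _ _)
    exact ⟨a, by rw [ha]; push_cast; ring⟩

/-- Because u is a unit modulo ℓ with inverse v, the product contains ℓB; the error ℓz in u v = 1 +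
ℓz is then harmless, as A = ℤ + ℓB. -/
lemma line_mul_line (h : IsSuborder A l ω p r) {u v z : B} (huv : u * v = 1 + l * z) :
    line A l u * line A l v = 1 := by
  have hc : ∀ b : B, (l : B) * b ∈ line A l u * line A l v := fun b => by
    have e : (l : B) * b = (l * (b * u)) * v - (l * b) * (l * z) := by
      linear_combination (-(l : B) * b) * huv
    rw [e]
    exact sub_mem
      (Submodule.mul_mem_mul (cond_le_line _ (mul_mem_cond _)) (self_mem_line _))
      (Submodule.mul_mem_mul (cond_le_line _ (mul_mem_cond _)) (cond_le_line _ (mul_mem_cond _)))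
  apply le_antisymm
  · rw [Submodule.mul_le]
    intro x hx y hy
    obtain ⟨k, c, rfl⟩ := h.mem_line.1 hx
    obtain ⟨k', c', rfl⟩ := h.mem_line.1 hy
    exact h.mem_one.2 ⟨k * k', k * k' * z + k * u * c' + c * k' * v + c * l * c', by
      push_cast; linear_combination (k : B) * k' * huv⟩
  · intro b hb
    obtain ⟨k, c, rfl⟩ := h.mem_one.1 hb
    have h1 : (1 : B) ∈ line A l u * line A l v := by
      rw [show (1 : B) = u * v - l * z by rw [huv]; ring]
      exact sub_mem (Submodule.mul_mem_mul (self_mem_line _) (self_mem_line _)) (hc z)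
    refine add_mem ?_ (hc c)
    simpa using zsmul_mem h1 k

lemma units_mul_top (I : (Submodule A B)ˣ) : (I : Submodule A B) * ⊤ = ⊤ := by
  refine top_le_iff.1 ?_
  calc (⊤ : Submodule A B) = I * (↑I⁻¹ * ⊤) := by rw [← mul_assoc, Units.mul_inv, one_mul]
    _ ≤ I * ⊤ := mul_le_mul_right le_top _

lemma cond_mul_top : cond A B l * ⊤ = cond A B l := by
  apply le_antisymm
  · rw [Submodule.mul_le]
    intro x hx y _
    obtain ⟨c, rfl⟩ := mem_cond.1 hx
    rw [mul_assoc]; exact mul_mem_cond _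
  · intro x hx
    rw [← mul_one x]; exact Submodule.mul_mem_mul hx trivial

/-- ℓB is an ideal of B inside A and I generates B, so ℓB = ℓB · I ⊆ A · I = I. Hence I is
determined by its image in the plane B/ℓB over 𝔽_ℓ. -/
lemma cond_le_units (h : IsSuborder A l ω p r) (I : (Submodule A B)ˣ) :
    cond A B l ≤ (I : Submodule A B) := by
  have h1 : cond A B l ≤ 1 := fun b hb => by
    obtain ⟨c, rfl⟩ := mem_cond.1 hb
    exact h.mem_one.2 ⟨0, c, by simp⟩
  calc cond A B l = cond A B l * (⊤ * I) := by rw [mul_comm ⊤, units_mul_top, cond_mul_top]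
    _ = cond A B l * I := by rw [← mul_assoc, cond_mul_top]
    _ ≤ 1 * I := mul_le_mul_left h1 _
    _ = I := one_mul _

/-- The image of I is not the whole plane: B is invertible over A only if B = A, but ω is not in A.
-/
lemma not_one_mem_and_gen_mem (h : IsSuborder A l ω p r) (hl : l.Prime) (I : (Submodule A B)ˣ)
    (h1 : (1 : B) ∈ (I : Submodule A B)) (hω : ω ∈ (I : Submodule A B)) : False := by
  have hI : (I : Submodule A B) = ⊤ := by
    refine top_le_iff.1 fun b _ => ?_
    obtain ⟨x, y, rfl⟩ := h.exists_rep b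
    have := add_mem (zsmul_mem h1 x) (zsmul_mem hω y)
    simpa using this
  have : (1 : Submodule A B) = ⊤ := by
    rw [← Units.mul_inv I, hI, mul_comm, units_mul_top]
  have hm : ω ∈ (1 : Submodule A B) := this ▸ trivial
  obtain ⟨a, ha⟩ := Submodule.mem_one.1 hm
  have := (h.mem_range 0 1).1 ⟨a, by simpa using ha⟩
  exact hl.one_lt.ne' (by exact_mod_cast Int.eq_one_of_dvd_one (by positivity) this)

lemma one_mem_of_int_mem (h : IsSuborder A l ω p r) (hl : l.Prime) (I : (Submodule A B)ˣ) {x : ℤ}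
    (hx : ¬ (l : ℤ) ∣ x) (hxI : (x : B) ∈ (I : Submodule A B)) : (1 : B) ∈ (I : Submodule A B) := by
  have hcop : IsCoprime (l : ℤ) x :=
    ((Nat.prime_iff_prime_int.1 hl).coprime_iff_not_dvd).2 hx
  obtain ⟨a, b, hab⟩ := hcop
  have e : (1 : B) = l * a + b • (x : B) := by
    have := congrArg (Int.cast : ℤ → B) hab
    push_cast at this
    rw [zsmul_eq_mul, ← this]; ring
  rw [e]
  exact add_mem (h.cond_le_units I (mul_mem_cond _)) (zsmul_mem hxI b)

lemma one_not_mem_of_sub_mem (h : IsSuborder A l ω p r) (hl : l.Prime) (I : (Submodule A B)ˣ)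
    {s : ℤ} (hs : ω - s ∈ (I : Submodule A B)) : (1 : B) ∉ (I : Submodule A B) := fun h1 =>
  h.not_one_mem_and_gen_mem hl I h1 (by
    have := add_mem hs (zsmul_mem h1 s)
    simpa using this)

lemma eq_one_of_one_mem (h : IsSuborder A l ω p r) (hl : l.Prime) (I : (Submodule A B)ˣ)
    (h1 : (1 : B) ∈ (I : Submodule A B)) : I = 1 := by
  ext b
  rw [Units.val_one, h.mem_one]
  constructor
  · intro hb
    obtain ⟨x, y, rfl⟩ := h.exists_rep b
    have hy : (l : ℤ) ∣ y := by
      by_contra hy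
      have hyω : (y : B) * ω ∈ (I : Submodule A B) := by
        have := sub_mem hb (zsmul_mem h1 x)
        simpa using this
      obtain ⟨a, b, hab⟩ : IsCoprime (l : ℤ) y :=
        ((Nat.prime_iff_prime_int.1 hl).coprime_iff_not_dvd).2 hy
      refine h.not_one_mem_and_gen_mem hl I h1 ?_
      have e : ω = l * (a * ω) + b • ((y : B) * ω) := by
        have := congrArg (Int.cast : ℤ → B) hab
        push_cast at this
        rw [zsmul_eq_mul]; linear_combination -ω * this
      rw [e]
      exact add_mem (h.cond_le_units I (mul_mem_cond _)) (zsmul_mem hyω b)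
    obtain ⟨z, rfl⟩ := hy
    exact ⟨x, z * ω, by push_cast; ring⟩
  · rintro ⟨k, c, rfl⟩
    refine add_mem ?_ (h.cond_le_units I (mul_mem_cond _))
    simpa using zsmul_mem h1 k

/-- The image of I is not zero either, because ℓB · B = ℓB while I · B = B. So it is a line, and a
line missing 1 is spanned by some ω - s. -/
lemma exists_sub_mem (h : IsSuborder A l ω p r) (hl : l.Prime) (I : (Submodule A B)ˣ)
    (h1 : (1 : B) ∉ (I : Submodule A B)) : ∃ s : ℤ, ω - s ∈ (I : Submodule A B) := by
  obtain ⟨b, hbI, hbc⟩ : ∃ b ∈ (I : Submodule A B), b ∉ cond A B l := by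
    by_contra hcon
    push Not at hcon
    have : (I : Submodule A B) = cond A B l := le_antisymm hcon (h.cond_le_units I)
    have h2 := units_mul_top I
    rw [this, cond_mul_top, ← this] at h2
    exact h1 (h2 ▸ trivial)
  obtain ⟨x, y, rfl⟩ := h.exists_rep b
  have hy : ¬ (l : ℤ) ∣ y := by
    rintro ⟨z, rfl⟩
    have hx : (x : B) ∈ (I : Submodule A B) := by
      have := sub_mem hbI (h.cond_le_units I (mul_mem_cond (z * ω)))
      push_cast at this
      simpa [mul_assoc] using this
    refine h1 (h.one_mem_of_int_mem hl I (fun hx' => hbc ?_) hx)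
    exact h.rep_mem_cond.2 ⟨hx', dvd_mul_right _ _⟩
  obtain ⟨a, b, hab⟩ : IsCoprime (l : ℤ) y :=
    ((Nat.prime_iff_prime_int.1 hl).coprime_iff_not_dvd).2 hy
  refine ⟨-(b * x), ?_⟩
  have e : ω - ((-(b * x) : ℤ) : B) = l * (a * ω) + b • ((x : B) + y * ω) := by
    have := congrArg (Int.cast : ℤ → B) hab
    push_cast at this
    rw [zsmul_eq_mul]; push_cast; linear_combination -ω * this
  rw [e]
  exact add_mem (h.cond_le_units I (mul_mem_cond _)) (zsmul_mem hbI b)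

lemma eq_line_of_sub_mem (h : IsSuborder A l ω p r) (hl : l.Prime) (I : (Submodule A B)ˣ) {s : ℤ}
    (hs : ω - s ∈ (I : Submodule A B)) : (I : Submodule A B) = line A l (ω - s) := by
  apply le_antisymm
  · intro b hb
    obtain ⟨x, y, rfl⟩ := h.exists_rep b
    have hd : (l : ℤ) ∣ x + y * s := by
      by_contra hd
      refine h.one_not_mem_of_sub_mem hl I hs (h.one_mem_of_int_mem hl I hd ?_)
      have := sub_mem hb (zsmul_mem hs y)
      rw [zsmul_eq_mul] at this
      convert this using 1
      push_cast; ring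
    obtain ⟨z, hz⟩ := hd
    have hz' := congrArg (Int.cast : ℤ → B) hz
    push_cast at hz'
    exact h.mem_line.2 ⟨y, z, by linear_combination hz'⟩
  · intro b hb
    obtain ⟨k, c, rfl⟩ := h.mem_line.1 hb
    refine add_mem ?_ (h.cond_le_units I (mul_mem_cond _))
    simpa using zsmul_mem hs k

/-- The norm of ω - s is (ω - s)(p - ω - s). Were it divisible by ℓ, the conjugate p - ω - s would
multiply I · B = B into ℓB and so lie in ℓB. -/
lemma not_dvd_of_sub_mem (h : IsSuborder A l ω p r) (hl : l.Prime) (I : (Submodule A B)ˣ) {s : ℤ}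
    (hs : ω - s ∈ (I : Submodule A B)) : ¬ (l : ℤ) ∣ s ^ 2 - p * s + r := by
  rintro ⟨z, hz⟩
  have hz' := congrArg (Int.cast : ℤ → B) hz
  push_cast at hz'
  have key : ∀ b ∈ (I : Submodule A B) * ⊤, (p - ω - s) * b ∈ cond A B l := by
    intro b hb
    refine Submodule.mul_induction_on hb (fun m hm n _ => ?_) (fun x y hx hy => ?_)
    · rw [h.eq_line_of_sub_mem hl I hs] at hm
      obtain ⟨k, c, rfl⟩ := h.mem_line.1 hm
      refine mem_cond.2 ⟨k * z * n + (p - ω - s) * c * n, ?_⟩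
      linear_combination (-(k : B) * n) * h.sq + (k : B) * n * hz'
    · rw [mul_add]; exact add_mem hx hy
  have := key 1 (by rw [units_mul_top]; trivial)
  have h2 := (h.rep_mem_cond (x := p - s) (y := -1)).1 (by
    convert this using 1; push_cast; ring)
  exact hl.one_lt.ne' (by exact_mod_cast Int.eq_one_of_dvd_one (by positivity) (dvd_neg.1 h2.2))

/-- A norm prime to ℓ makes a multiple of the conjugate p - ω - s inverse to ω - s modulo ℓ. -/
lemma exists_unit_of_not_dvd (h : IsSuborder A l ω p r) (hl : l.Prime) {s : ℤ}
    (hs : ¬ (l : ℤ) ∣ s ^ 2 - p * s + r) : ∃ I : (Submodule A B)ˣ, ω - s ∈ (I : Submodule A B) := by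
  obtain ⟨a, b, hab⟩ : IsCoprime (l : ℤ) (s ^ 2 - p * s + r) :=
    ((Nat.prime_iff_prime_int.1 hl).coprime_iff_not_dvd).2 hs
  have hab' := congrArg (Int.cast : ℤ → B) hab
  push_cast at hab'
  have e := h.line_mul_line (u := ω - s) (v := b * (p - ω - s)) (z := -a) (by
    linear_combination (-(b : B)) * h.sq + hab')
  exact ⟨⟨_, _, e, by rw [mul_comm, e]⟩, self_mem_line _⟩

/-- The number of invertible `A`-submodules of `B`. -/
theorem card_units (h : IsSuborder A l ω p r) (hl : l.Prime) :
    Nat.card (Submodule A B)ˣ + nroots l p r = l + 1 := by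
  classical
  have : Fact l.Prime := ⟨hl⟩
  have hcast : ∀ s : ZMod l, s ^ 2 - p * s + r ≠ 0 ↔
      ¬ (l : ℤ) ∣ (s.val : ℤ) ^ 2 - p * s.val + r := fun s => by
    rw [not_iff_not, ← ZMod.intCast_zmod_eq_zero_iff_dvd]
    push_cast
    rw [ZMod.natCast_zmod_val]
  choose f hf using fun s : {s : ZMod l // s ^ 2 - p * s + r ≠ 0} =>
    h.exists_unit_of_not_dvd hl ((hcast s).1 s.2)
  -- `none` is the line through 1 and `some s` the line through ω - s: the points of the projective
  -- line over 𝔽_ℓ, with the roots removed.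
  let g : Option {s : ZMod l // s ^ 2 - p * s + r ≠ 0} → (Submodule A B)ˣ := fun o => o.elim 1 f
  have hg : Function.Bijective g := by
    constructor
    · have h1 : ∀ s, f s ≠ 1 := fun s hs => by
        have := h.one_not_mem_of_sub_mem hl _ (hf s)
        rw [hs] at this
        exact this (Submodule.one_le.1 le_rfl)
      rintro (_ | s) (_ | s') hss
      · rfl
      · exact absurd hss.symm (h1 s')
      · exact absurd hss (h1 s)
      · have hss : f s = f s' := hss
        have h2 := hf s'
        rw [← hss] at h2
        have h3 := sub_mem h2 (hf s)
        by_contra hne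
        refine h.one_not_mem_of_sub_mem hl _ (hf s) (h.one_mem_of_int_mem hl _
          (x := (s.1.val : ℤ) - s'.1.val) (fun hd => hne ?_) (by convert h3 using 1; push_cast; ring))
        rw [← ZMod.intCast_zmod_eq_zero_iff_dvd] at hd
        push_cast at hd
        rw [ZMod.natCast_zmod_val, ZMod.natCast_zmod_val, sub_eq_zero] at hd
        exact congrArg some (Subtype.ext hd)
    · intro I
      by_cases h1 : (1 : B) ∈ (I : Submodule A B)
      · exact ⟨none, (h.eq_one_of_one_mem hl I h1).symm⟩
      · obtain ⟨s, hs⟩ := h.exists_sub_mem hl I h1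
        have hnd := h.not_dvd_of_sub_mem hl I hs
        have hs0 : ((s : ZMod l)) ^ 2 - p * s + r ≠ 0 := by
          intro h0
          apply hnd
          rw [← ZMod.intCast_zmod_eq_zero_iff_dvd]
          push_cast; exact h0
        refine ⟨some ⟨s, hs0⟩, ?_⟩
        change f ⟨s, hs0⟩ = I
        have h2 := hf ⟨s, hs0⟩
        have h3 : (l : ℤ) ∣ s - ((s : ZMod l).val : ℤ) := by
          rw [← ZMod.intCast_zmod_eq_zero_iff_dvd]; push_cast
          rw [ZMod.natCast_zmod_val, sub_self]
        obtain ⟨z, hz⟩ := h3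
        have hz' := congrArg (Int.cast : ℤ → B) hz
        push_cast at hz'
        have h4 : ω - s ∈ (f ⟨s, hs0⟩ : Submodule A B) := by
          have e : ω - s = (ω - ((s : ZMod l).val : ℤ)) - l * z := by
            push_cast; linear_combination -hz'
          rw [e]
          exact sub_mem (by exact_mod_cast h2) (h.cond_le_units _ (mul_mem_cond _))
        exact Units.ext ((h.eq_line_of_sub_mem hl _ h4).trans (h.eq_line_of_sub_mem hl _ hs).symm)
  rw [← Nat.card_eq_of_bijective g hg, nroots]
  have h5 := Fintype.card_subtype_compl (fun s : ZMod l => s ^ 2 - p * s + r = 0)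
  have h6 := Fintype.card_subtype_le (fun s : ZMod l => s ^ 2 - p * s + r = 0)
  rw [ZMod.card] at h5 h6
  simp only [Nat.card_eq_fintype_card, Fintype.card_option]
  simp only [ne_eq]
  omega

end IsSuborder

end EllipticTerm

/-! ### Picard groups of an order and its suborder. -/

namespace EllipticTerm

open CommRing TensorProduct

/-- An invertible submodule `J` of a ring extension is generated by one element up to `a J`, if
`B / a B` is finite. -/
lemma exists_generator_mod {B K : Type*} [CommRing B] [CommRing K] [Algebra B K] [FaithfulSMul B K]
    (I : Ideal B) [Finite (B ⧸ I)] (J : (Submodule B K)ˣ) :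
    ∃ u ∈ (J : Submodule B K), ∀ j ∈ (J : Submodule B K),
      ∃ b : B, j - b • u ∈ I • (J : Submodule B K) := by
  -- An invertible module over a finite ring is free.
  have hfree : Module.Free (B ⧸ I) ((B ⧸ I) ⊗[B] (J : Submodule B K)) := inferInstance
  obtain ⟨e⟩ := (Module.Invertible.free_iff_linearEquiv (R := B ⧸ I)
    (M := (B ⧸ I) ⊗[B] (J : Submodule B K))).1 hfree
  let q := quotTensorEquivQuotSMul (J : Submodule B K) I
  obtain ⟨u, hu⟩ := Submodule.mkQ_surjective _ (q (e.symm 1))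
  refine ⟨u, u.2, fun j hj => ?_⟩
  obtain ⟨b, hb⟩ := Ideal.Quotient.mk_surjective (e (q.symm (Submodule.Quotient.mk ⟨j, hj⟩)))
  have h1 : q.symm (Submodule.Quotient.mk ⟨j, hj⟩) = b • e.symm 1 := by
    apply e.injective
    rw [← hb, ← algebraMap_smul (B ⧸ I) b, map_smul, e.apply_symm_apply, smul_eq_mul, mul_one]
    rfl
  have h2 : (Submodule.Quotient.mk ⟨j, hj⟩ : (J : Submodule B K) ⧸ (I • (⊤ : Submodule B (J : Submodule B K)))) =
      Submodule.Quotient.mk (b • u) := by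
    apply q.symm.injective
    rw [h1, Submodule.Quotient.mk_smul, map_smul]
    congr 1
    rw [LinearEquiv.eq_symm_apply]; exact hu.symm
  rw [Submodule.Quotient.eq] at h2
  have h3 := Submodule.mem_map_of_mem (f := (J : Submodule B K).subtype) h2
  rw [Submodule.map_smul'', Submodule.map_top, Submodule.range_subtype] at h3
  exact ⟨b, h3⟩

namespace IsSuborder

variable {A B : Type*} [CommRing A] [CommRing B] [Algebra A B] {l : ℕ} {ω : B} {p r : ℤ}

lemma finite_quotient (h : IsSuborder A l ω p r) (hl : l.Prime) :
    Finite (B ⧸ Ideal.span {(l : B)}) := by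
  have : NeZero l := ⟨hl.ne_zero⟩
  refine Finite.of_surjective (fun z : ZMod l × ZMod l =>
    Ideal.Quotient.mk (Ideal.span {(l : B)}) ((z.1.val : B) + z.2.val * ω)) fun b => ?_
  obtain ⟨b, rfl⟩ := Ideal.Quotient.mk_surjective b
  obtain ⟨x, y, rfl⟩ := h.exists_rep b
  refine ⟨(x, y), ?_⟩
  have hd : ∀ x : ℤ, ∃ z : ℤ, x = (x : ZMod l).val + l * z := fun x => by
    obtain ⟨z, hz⟩ : (l : ℤ) ∣ x - ((x : ZMod l).val : ℤ) := by
      rw [← ZMod.intCast_zmod_eq_zero_iff_dvd]; push_cast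
      rw [ZMod.natCast_zmod_val, sub_self]
    exact ⟨z, by linarith⟩
  obtain ⟨z, hz⟩ := hd x
  obtain ⟨z', hz'⟩ := hd y
  have e := congrArg (Int.cast : ℤ → B) hz
  have e' := congrArg (Int.cast : ℤ → B) hz'
  push_cast at e e'
  rw [Ideal.Quotient.eq, Ideal.mem_span_singleton]
  exact ⟨-(z + z' * ω), by dsimp only; linear_combination -e - ω * e'⟩

lemma faithfulSMul_of_tower {K : Type*} [Field K] [Algebra A K] [Algebra B K]
    [IsScalarTower A B K] [FaithfulSMul A K] : FaithfulSMul A B := by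
  rw [faithfulSMul_iff_algebraMap_injective]
  have := FaithfulSMul.algebraMap_injective A K
  rw [IsScalarTower.algebraMap_eq A B K] at this
  exact Function.Injective.of_comp this

lemma mul_mem_span_smul {K : Type*} [Field K] [Algebra B K] (J : Submodule B K) {x : K} :
    x ∈ (Ideal.span {(l : B)}) • J ↔ ∃ y ∈ J, x = l * y := by
  rw [Submodule.ideal_span_singleton_smul, Submodule.mem_smul_pointwise_iff_exists]
  simp only [Algebra.smul_def, map_natCast, eq_comm]

/-- Represent a class by an invertible J ⊆ K and let u, v generate J, J⁻¹ modulo ℓ. Then L = A u +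
ℓJ is invertible over A with inverse A w' v + ℓJ⁻¹, where w' inverts u v modulo ℓ, and B ⊗ L maps
onto J, hence isomorphically. -/
theorem mapAlgebra_surjective (h : IsSuborder A l ω p r) (hl : l.Prime) (K : Type*) [Field K]
    [Algebra A K] [Algebra B K] [IsScalarTower A B K] [FaithfulSMul A K] [FaithfulSMul B K] :
    Function.Surjective (Pic.mapAlgebra A B) := by
  intro M
  have : Finite (B ⧸ Ideal.span {(l : B)}) := h.finite_quotient hl
  -- Pic K is trivial, so every class of Pic B is represented inside K.
  obtain ⟨J, rfl⟩ : ∃ J, Submodule.unitsToPic B K J = M := by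
    have : M ∈ (Submodule.unitsToPic B K).range := by
      rw [Submodule.range_unitsToPic, relPic_eq_top]; trivial
    exact this
  have hinj := FaithfulSMul.algebraMap_injective B K
  obtain ⟨u, hu, hgu⟩ := exists_generator_mod (Ideal.span {(l : B)}) J
  obtain ⟨v, hv, hgv⟩ := exists_generator_mod (Ideal.span {(l : B)}) J⁻¹
  simp only [mul_mem_span_smul] at hgu hgv
  have hone : ∀ {x y : K}, x ∈ (J : Submodule B K) → y ∈ ((J⁻¹ : (Submodule B K)ˣ) : Submodule B K) →
      ∃ b : B, algebraMap B K b = x * y := fun hx hy => by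
    have := Submodule.mul_mem_mul hx hy
    rw [Units.mul_inv] at this
    exact Submodule.mem_one.1 this
  obtain ⟨w, hw⟩ := hone hu hv
  -- `w` is a unit modulo `ℓ`
  obtain ⟨w', z, hww⟩ : ∃ w' z : B, w * w' = 1 + l * z := by
    have h1 : (1 : K) ∈ (J : Submodule B K) * ((J⁻¹ : (Submodule B K)ˣ) : Submodule B K) := by
      rw [Units.mul_inv]; exact Submodule.one_le.1 le_rfl
    have h2 : ∀ x ∈ (J : Submodule B K) * ((J⁻¹ : (Submodule B K)ˣ) : Submodule B K),
        ∃ b c : B, x = algebraMap B K (w * b + l * c) := by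
      intro x hx
      refine Submodule.mul_induction_on hx (fun m hm n hn => ?_) ?_
      · obtain ⟨b, m', hm', e⟩ := hgu m hm
        obtain ⟨c, n', hn', e'⟩ := hgv n hn
        obtain ⟨d, hd⟩ := hone hm' hn
        obtain ⟨d', hd'⟩ := hone hu hn'
        refine ⟨b * c, d + b * d', ?_⟩
        rw [Algebra.smul_def] at e e'
        simp only [map_add, map_mul, map_natCast, hw, hd, hd']
        linear_combination n * e + algebraMap B K b * u * e'
      · rintro x y ⟨b, c, rfl⟩ ⟨b', c', rfl⟩
        exact ⟨b + b', c + c', by rw [← map_add]; congr 1; ring⟩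
    obtain ⟨b, c, hbc⟩ := h2 1 h1
    rw [← map_one (algebraMap B K)] at hbc
    exact ⟨b, -c, by linear_combination -(hinj hbc)⟩
  -- the candidate module
  let L : Submodule A K :=
    Submodule.span A {u} ⊔ ((Ideal.span {(l : B)}) • (J : Submodule B K)).restrictScalars A
  have hLm : ∀ x, x ∈ L ↔ ∃ (a : A), ∃ j ∈ (J : Submodule B K),
      x = algebraMap A K a * u + l * j := fun x => by
    rw [Submodule.mem_sup]
    constructor
    · rintro ⟨y, hy, t, ht, rfl⟩
      obtain ⟨a, rfl⟩ := Submodule.mem_span_singleton.1 hy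
      obtain ⟨j, hj, rfl⟩ := mul_mem_span_smul _ |>.1 ht
      exact ⟨a, j, hj, by rw [Algebra.smul_def]⟩
    · rintro ⟨a, j, hj, rfl⟩
      exact ⟨_, Submodule.mem_span_singleton.2 ⟨a, Algebra.smul_def a u⟩, _,
        mul_mem_span_smul _ |>.2 ⟨j, hj, rfl⟩, rfl⟩
  let L' : Submodule A K := Submodule.span A {algebraMap B K w' * v} ⊔
    ((Ideal.span {(l : B)}) • ((J⁻¹ : (Submodule B K)ˣ) : Submodule B K)).restrictScalars A
  have hLm' : ∀ x, x ∈ L' ↔ ∃ (a : A), ∃ j ∈ ((J⁻¹ : (Submodule B K)ˣ) : Submodule B K),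
      x = algebraMap A K a * (algebraMap B K w' * v) + l * j := fun x => by
    rw [Submodule.mem_sup]
    constructor
    · rintro ⟨y, hy, t, ht, rfl⟩
      obtain ⟨a, rfl⟩ := Submodule.mem_span_singleton.1 hy
      obtain ⟨j, hj, rfl⟩ := mul_mem_span_smul _ |>.1 ht
      exact ⟨a, j, hj, by rw [Algebra.smul_def]⟩
    · rintro ⟨a, j, hj, rfl⟩
      exact ⟨_, Submodule.mem_span_singleton.2 ⟨a, Algebra.smul_def _ _⟩, _,
        mul_mem_span_smul _ |>.2 ⟨j, hj, rfl⟩, rfl⟩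
  have hA : ∀ (b : B), ∃ a : A, algebraMap A K a = l * algebraMap B K b := fun b => by
    obtain ⟨a, ha⟩ := Submodule.mem_one.1 (h.mem_one.2 ⟨0, b, rfl⟩)
    exact ⟨a, by rw [IsScalarTower.algebraMap_apply A B K, ha]; simp⟩
  have hAB : ∀ a : A, algebraMap A K a = algebraMap B K (algebraMap A B a) :=
    fun a => IsScalarTower.algebraMap_apply A B K a
  have hww' := congrArg (algebraMap B K) hww
  simp only [map_add, map_mul, map_natCast, map_one, hw] at hww'
  have hLL' : L * L' = 1 := by
    have huL : u ∈ L := (hLm _).2 ⟨1, 0, zero_mem _, by simp⟩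
    have hvL : algebraMap B K w' * v ∈ L' := (hLm' _).2 ⟨1, 0, zero_mem _, by simp⟩
    have hJL : ∀ j ∈ (J : Submodule B K), (l : K) * j ∈ L := fun j hj =>
      (hLm _).2 ⟨0, j, hj, by simp⟩
    have hJL' : ∀ j ∈ ((J⁻¹ : (Submodule B K)ˣ) : Submodule B K), (l : K) * j ∈ L' := fun j hj =>
      (hLm' _).2 ⟨0, j, hj, by simp⟩
    have hwv : algebraMap B K w' * v ∈ ((J⁻¹ : (Submodule B K)ˣ) : Submodule B K) := by
      rw [← Algebra.smul_def]; exact Submodule.smul_mem _ _ hv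
    have hbu : ∀ b : B, algebraMap B K b * u ∈ (J : Submodule B K) := fun b => by
      rw [← Algebra.smul_def]; exact Submodule.smul_mem _ _ hu
    have hbv : ∀ b : B, algebraMap B K b * v ∈ ((J⁻¹ : (Submodule B K)ˣ) : Submodule B K) :=
      fun b => by rw [← Algebra.smul_def]; exact Submodule.smul_mem _ _ hv
    have hsq : ∀ b : B, (l : K) * l * algebraMap B K b ∈ L * L' := by
      have : ∀ x ∈ (J : Submodule B K) * ((J⁻¹ : (Submodule B K)ˣ) : Submodule B K),
          (l : K) * l * x ∈ L * L' := fun x hx => by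
        refine Submodule.mul_induction_on hx (fun m hm n hn => ?_) (fun x y hx hy => ?_)
        · rw [show (l : K) * l * (m * n) = (l * m) * (l * n) by ring]
          exact Submodule.mul_mem_mul (hJL m hm) (hJL' n hn)
        · rw [mul_add]; exact add_mem hx hy
      intro b
      apply this
      rw [Units.mul_inv]
      exact Submodule.mem_one.2 ⟨b, rfl⟩
    have hcL : ∀ b : B, (l : K) * algebraMap B K b ∈ L * L' := fun b => by
      rw [show (l : K) * algebraMap B K b = (l * (algebraMap B K b * u)) * (algebraMap B K w' * v)
        - l * l * algebraMap B K (b * z) by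
          rw [map_mul]; linear_combination (-(l : K) * algebraMap B K b) * hww']
      exact sub_mem (Submodule.mul_mem_mul (hJL _ (hbu b)) hvL) (hsq _)
    apply le_antisymm
    · rw [Submodule.mul_le]
      intro x hx y hy
      obtain ⟨a, j, hj, rfl⟩ := (hLm _).1 hx
      obtain ⟨a', j', hj', rfl⟩ := (hLm' _).1 hy
      obtain ⟨b1, hb1⟩ := hone hu hj'
      obtain ⟨b2, hb2⟩ := hone hj hwv
      obtain ⟨b3, hb3⟩ := hone hj hj'
      obtain ⟨c, hc⟩ := hA (algebraMap A B a * algebraMap A B a' * z + algebraMap A B a * b1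
        + algebraMap A B a' * b2 + l * b3)
      refine Submodule.mem_one.2 ⟨a * a' + c, ?_⟩
      simp only [map_add, map_mul, map_natCast, hc, ← hAB, hb1, hb2, hb3]
      linear_combination (-algebraMap A K a * algebraMap A K a') * hww'
    · rw [Submodule.one_le, show (1 : K) = u * (algebraMap B K w' * v) - l * algebraMap B K z by
        linear_combination -hww']
      exact sub_mem (Submodule.mul_mem_mul huL hvL) (hcL z)
  obtain ⟨I, hI⟩ : ∃ I : (Submodule A K)ˣ, (I : Submodule A K) = L :=
    ⟨⟨L, L', hLL', by rw [mul_comm, hLL']⟩, rfl⟩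
  refine ⟨Submodule.unitsToPic A K I, ?_⟩
  have hLJ : ∀ x ∈ L, x ∈ (J : Submodule B K) := fun x hx => by
    obtain ⟨a, j, hj, rfl⟩ := (hLm _).1 hx
    rw [hAB, ← Algebra.smul_def]
    refine add_mem (Submodule.smul_mem _ _ hu) ?_
    have := Submodule.smul_mem (J : Submodule B K) (l : B) hj
    rwa [Algebra.smul_def, map_natCast] at this
  let inc : (I : Submodule A K) →ₗ[A] (J : Submodule B K) :=
    { toFun := fun x => ⟨x, hLJ x (hI ▸ x.2)⟩
      map_add' := fun _ _ => rfl
      map_smul' := fun _ _ => rfl }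
  have hsurj : Function.Surjective (inc.liftBaseChange B) := by
    rintro ⟨j, hj⟩
    obtain ⟨b, j', hj', e⟩ := hgu j hj
    refine ⟨b ⊗ₜ ⟨u, hI ▸ (hLm _).2 ⟨1, 0, zero_mem _, by simp⟩⟩ +
      1 ⊗ₜ ⟨l * j', hI ▸ (hLm _).2 ⟨0, j', hj', by simp⟩⟩, ?_⟩
    rw [map_add, LinearMap.liftBaseChange_tmul, LinearMap.liftBaseChange_tmul]
    apply Subtype.ext
    change b • u + (1 : B) • ((l : K) * j') = j
    rw [one_smul, ← e]; ring
  have hinv : Module.Invertible A (I : Submodule A K) := inferInstance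
  have hinv' : Module.Invertible B (B ⊗[A] (I : Submodule A K)) := inferInstance
  have hbij := Module.Invertible.bijective_of_surjective hsurj
  refine Pic.mk_eq_mk_iff.2 ⟨?_⟩
  exact (AlgebraTensorModule.congr (LinearEquiv.refl B B) (Submodule.unitsToPicEquiv I)).trans
    (LinearEquiv.ofBijective _ hbij)

/-- The class number relation for an order and its suborder of prime index. -/
theorem card_classGroup_mul (h : IsSuborder A l ω p r) (hl : l.Prime) [IsDomain A] [IsDomain B]
    (K : Type*) [Field K]
    [Algebra A K] [Algebra B K] [IsScalarTower A B K] [FaithfulSMul A K] [FaithfulSMul B K] :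
    Nat.card (ClassGroup A) *
      Nat.card (Units.map (Submodule.spanSingleton (A := B) A).toMonoidHom).range =
      Nat.card (ClassGroup B) * Nat.card (Submodule A B)ˣ := by
  have : FaithfulSMul A B := faithfulSMul_of_tower (K := K)
  -- The kernel of Pic A → Pic B is the group of invertible submodules of B modulo the principal
  -- ones; both quotients are counted by Lagrange.
  rw [Nat.card_congr (ClassGroup.equivPic A).toEquiv, Nat.card_congr (ClassGroup.equivPic B).toEquiv,
    Subgroup.card_eq_card_quotient_mul_card_subgroup
      (Units.map (Submodule.spanSingleton (A := B) A).toMonoidHom).range,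
    Nat.card_congr (Submodule.unitsQuotEquivRelPic A B).toEquiv,
    Subgroup.card_eq_card_quotient_mul_card_subgroup (relPic A B), relPic,
    Nat.card_congr (QuotientGroup.quotientKerEquivOfSurjective _
      (h.mapAlgebra_surjective hl K)).toEquiv, mul_assoc]

end IsSuborder

end EllipticTerm

/-! ### Units of imaginary quadratic orders, and class numbers of discriminants D and ℓ²D. -/

namespace EllipticTerm

namespace IsSuborder

variable {A B : Type*} [CommRing A] [CommRing B] [Algebra A B] {l : ℕ} {ω : B} {p r : ℤ}

/-- The norm x² + pxy + ry² of a unit is ±1, and it is nonnegative since the discriminant is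
negative; multiply by 4 and complete the square. -/
lemma units_rep (h : IsSuborder A l ω p r) (hD : p ^ 2 - 4 * r < 0) (u : Bˣ) :
    ∃ x y : ℤ, (u : B) = x + y * ω ∧ (2 * x + p * y) ^ 2 - (p ^ 2 - 4 * r) * y ^ 2 = 4 := by
  obtain ⟨x, y, hu⟩ := h.exists_rep u
  obtain ⟨x', y', hv⟩ := h.exists_rep (↑u⁻¹ : B)
  refine ⟨x, y, hu, ?_⟩
  have huv := u.mul_inv
  rw [hu, hv] at huv
  obtain ⟨h1, h2⟩ := h.rep_zero (x * x' - r * (y * y') - 1) (x * y' + x' * y + p * (y * y')) (by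
    push_cast
    linear_combination huv - (y : B) * y' * h.sq)
  have hN : (x ^ 2 + p * x * y + r * y ^ 2) * (x' ^ 2 + p * x' * y' + r * y' ^ 2) = 1 := by
    linear_combination (x * x' - r * (y * y') + 1 + p * (x * y' + x' * y + p * (y * y'))) * h1
      + (p + r * (x * y' + x' * y + p * (y * y'))) * h2
  have hpos : 0 ≤ x ^ 2 + p * x * y + r * y ^ 2 := by
    nlinarith [sq_nonneg (2 * x + p * y), sq_nonneg y]
  have h3 : x ^ 2 + p * x * y + r * y ^ 2 = 1 := by
    rcases Int.mul_eq_one_iff_eq_one_or_neg_one.1 hN with h | h <;> omega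
  linear_combination 4 * h3

/-- The class in `(Submodule A B)ˣ` of the principal submodule `A u`. -/
noncomputable abbrev principal (A : Type*) {B : Type*} [CommRing A] [CommRing B] [Algebra A B] :
    Bˣ →* (Submodule A B)ˣ :=
  Units.map (Submodule.spanSingleton (A := B) A).toMonoidHom

lemma coe_principal (u : Bˣ) : (principal A u : Submodule A B) = Submodule.span A {(u : B)} := rfl

lemma principal_neg (u : Bˣ) : principal A (-u) = principal A u := by
  ext1
  rw [coe_principal, coe_principal, Units.val_neg, ← Set.neg_singleton, Submodule.span_neg]

lemma self_mem_principal (u : Bˣ) : (u : B) ∈ (principal A u : Submodule A B) :=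
  Submodule.mem_span_singleton_self _

/-- Equal modules would contain the difference 1, hence also ω. -/
lemma principal_ne_of_sub_eq_one (h : IsSuborder A l ω p r) (hl : l.Prime) {u v : Bˣ} {x : ℤ}
    (hv : (v : B) = x + ω) (huv : (v : B) - u = 1) : principal A u ≠ principal A v := fun he => by
  have hu := self_mem_principal (A := A) u
  have hv' := self_mem_principal (A := A) v
  rw [he] at hu
  have h1 := sub_mem hv' hu
  rw [huv] at h1
  refine h.not_one_mem_and_gen_mem hl _ h1 ?_
  have := sub_mem hv' (zsmul_mem h1 x)
  rw [hv] at this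
  simpa using this

lemma principal_ne_one (h : IsSuborder A l ω p r) (hl : l.Prime) {v : Bˣ} {x : ℤ}
    (hv : (v : B) = x + ω) : principal A v ≠ 1 := fun he => by
  have hv' := self_mem_principal (A := A) v
  rw [he] at hv'
  have h1 : (1 : B) ∈ ((1 : (Submodule A B)ˣ) : Submodule A B) := Submodule.one_le.1 le_rfl
  refine h.not_one_mem_and_gen_mem hl _ h1 ?_
  have := sub_mem hv' (zsmul_mem h1 x)
  rw [hv] at this
  simpa using this

lemma card_principal_of_lt (h : IsSuborder A l ω p r) (hD : p ^ 2 - 4 * r < -4) :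
    Nat.card (principal (B := B) A).range = 1 := by
  have : (principal (B := B) A).range = ⊥ := by
    rw [eq_bot_iff]
    rintro _ ⟨u, rfl⟩
    rw [Subgroup.mem_bot]
    obtain ⟨x, y, hu, hxy⟩ := h.units_rep (by linarith) u
    have hy : y = 0 := by
      by_contra hy
      have : 1 ≤ y ^ 2 := by have := sq_pos_of_ne_zero hy; linarith
      nlinarith [sq_nonneg (2 * x + p * y)]
    subst hy
    have hx : x = 1 ∨ x = -1 := by
      have : (x - 1) * (x + 1) = 0 := by nlinarith
      rcases mul_eq_zero.1 this with h | h
      · left; linarith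
      · right; linarith
    rcases hx with rfl | rfl
    · have : u = 1 := Units.ext (by simpa using hu)
      rw [this, map_one]
    · have : u = -1 := Units.ext (by simpa using hu)
      rw [this, principal_neg, map_one]
  rw [this]; simp

/-- Here ω plays the role of (-4 + √-4)/2 = -2 + i, so 2 + ω is i. -/
lemma card_principal_of_neg_four (h : IsSuborder A l ω (-4) 5) (hl : l.Prime) :
    Nat.card (principal (B := B) A).range = 2 := by
  have hi : (2 + ω) * -(2 + ω) = 1 := by linear_combination -h.sq
  let i : Bˣ := ⟨2 + ω, -(2 + ω), hi, by rw [mul_comm, hi]⟩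
  have : ((principal (B := B) A).range : Set (Submodule A B)ˣ) = {principal A i, 1} := by
    ext I
    constructor
    · rintro ⟨u, rfl⟩
      obtain ⟨x, y, hu, hxy⟩ := h.units_rep (by norm_num) u
      have hy : y ≤ 1 ∧ -1 ≤ y := by
        constructor <;> nlinarith [sq_nonneg (2 * x + -4 * y)]
      obtain rfl | rfl | rfl : y = 0 ∨ y = 1 ∨ y = -1 := by omega
      · have hx : x = 1 ∨ x = -1 := by
          have : (x - 1) * (x + 1) = 0 := by nlinarith
          rcases mul_eq_zero.1 this with h | h
          · left; linarith
          · right; linarith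
        right
        rcases hx with rfl | rfl
        · have : u = 1 := Units.ext (by simpa using hu)
          rw [this, map_one]; rfl
        · have : u = -1 := Units.ext (by simpa using hu)
          rw [this, principal_neg, map_one]; rfl
      · have hx : x = 2 := by
          have : (x - 2) ^ 2 = 0 := by nlinarith
          have := pow_eq_zero_iff (two_ne_zero) |>.1 this
          linarith
        subst hx
        left
        have : u = i := Units.ext (by rw [hu]; simp [i])
        rw [this]
      · have hx : x = -2 := by
          have : (x + 2) ^ 2 = 0 := by nlinarith
          have := pow_eq_zero_iff (two_ne_zero) |>.1 this
          linarith
        subst hx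
        left
        have : u = -i := Units.ext (by rw [hu, Units.val_neg]; simp only [i]; push_cast; ring)
        rw [this, principal_neg]
    · rintro (rfl | rfl)
      · exact ⟨i, rfl⟩
      · exact one_mem _
  have hne := h.principal_ne_one hl (v := i) (x := 2) (by simp [i])
  rw [← Set.ncard_pair hne, ← this]; rfl

/-- Here ω plays the role of (-3 + √-3)/2, so 1 + ω and 2 + ω are primitive cube and sixth roots of
unity. -/
lemma card_principal_of_neg_three (h : IsSuborder A l ω (-3) 3) (hl : l.Prime) :
    Nat.card (principal (B := B) A).range = 3 := by
  have hi : (1 + ω) * -(2 + ω) = 1 := by linear_combination -h.sq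
  let i : Bˣ := ⟨1 + ω, -(2 + ω), hi, by rw [mul_comm, hi]⟩
  have hj : (2 + ω) * -(1 + ω) = 1 := by linear_combination -h.sq
  let j : Bˣ := ⟨2 + ω, -(1 + ω), hj, by rw [mul_comm, hj]⟩
  have : ((principal (B := B) A).range : Set (Submodule A B)ˣ) =
      {principal A i, principal A j, 1} := by
    ext I
    constructor
    · rintro ⟨u, rfl⟩
      obtain ⟨x, y, hu, hxy⟩ := h.units_rep (by norm_num) u
      have hy : y ≤ 1 ∧ -1 ≤ y := by
        constructor <;> nlinarith [sq_nonneg (2 * x + -3 * y)]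
      obtain rfl | rfl | rfl : y = 0 ∨ y = 1 ∨ y = -1 := by omega
      · have hx : x = 1 ∨ x = -1 := by
          have : (x - 1) * (x + 1) = 0 := by nlinarith
          rcases mul_eq_zero.1 this with h | h
          · left; linarith
          · right; linarith
        right; right
        rcases hx with rfl | rfl
        · have : u = 1 := Units.ext (by simpa using hu)
          rw [this, map_one]; rfl
        · have : u = -1 := Units.ext (by simpa using hu)
          rw [this, principal_neg, map_one]; rfl
      · have hx : x = 1 ∨ x = 2 := by
          have : (x - 1) * (x - 2) = 0 := by nlinarith
          rcases mul_eq_zero.1 this with h | h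
          · left; linarith
          · right; linarith
        rcases hx with rfl | rfl
        · left
          have : u = i := Units.ext (by rw [hu]; simp [i])
          rw [this]
        · right; left
          have : u = j := Units.ext (by rw [hu]; simp [j])
          rw [this]
      · have hx : x = -1 ∨ x = -2 := by
          have : (x + 1) * (x + 2) = 0 := by nlinarith
          rcases mul_eq_zero.1 this with h | h
          · left; linarith
          · right; linarith
        rcases hx with rfl | rfl
        · left
          have : u = -i := Units.ext (by rw [hu, Units.val_neg]; simp only [i]; push_cast; ring)
          rw [this, principal_neg]
        · right; left
          have : u = -j := Units.ext (by rw [hu, Units.val_neg]; simp only [j]; push_cast; ring)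
          rw [this, principal_neg]
    · rintro (rfl | rfl | rfl)
      · exact ⟨i, rfl⟩
      · exact ⟨j, rfl⟩
      · exact one_mem _
  have hi1 := h.principal_ne_one hl (v := i) (x := 1) (by simp [i])
  have hj1 := h.principal_ne_one hl (v := j) (x := 2) (by simp [j])
  have hij := h.principal_ne_of_sub_eq_one hl (u := i) (v := j) (x := 2) (by simp [j])
    (by simp only [i, j]; ring)
  rw [← Set.ncard_eq_three.2 ⟨_, _, _, hij, hi1, hj1, this⟩]; rfl

end IsSuborder

/-- The generator of the quadratic order of discriminant `D`. -/
noncomputable def quadGen (D : ℤ) : ℂ := ((D : ℂ) + Complex.I * (Real.sqrt (-(D : ℝ)) : ℂ)) / 2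

lemma quadGen_sq {D r : ℤ} (hD : D < 0) (hr : 4 * r = D ^ 2 - D) :
    quadGen D * quadGen D = D * quadGen D - r := by
  have h1 : ((Real.sqrt (-(D : ℝ)) : ℝ) : ℂ) ^ 2 = -D := by
    rw [← Complex.ofReal_pow, Real.sq_sqrt (by simpa using hD.le)]; push_cast; rfl
  have h2 : (4 : ℂ) * r = D ^ 2 - D := by exact_mod_cast hr
  unfold quadGen
  linear_combination (Complex.I ^ 2 / 4) * h1 - D / 4 * Complex.I_sq + h2 / 4

/-- Up to an integer translation the generator is multiplied by ℓ, so the order of discriminant ℓ²D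
is ℤ + ℓB with B the order of discriminant D. -/
lemma quadGen_mul {D : ℤ} (l : ℕ) (k : ℤ) (hk : 2 * k = (l : ℤ) ^ 2 - l) :
    quadGen ((l : ℤ) ^ 2 * D) = l * quadGen D + k * D := by
  have h1 : Real.sqrt (-(((l : ℤ) ^ 2 * D : ℤ) : ℝ)) = l * Real.sqrt (-(D : ℝ)) := by
    rw [← Real.sqrt_sq (Nat.cast_nonneg l : (0 : ℝ) ≤ l), ← Real.sqrt_mul (by positivity)]
    congr 1
    push_cast
    ring
  have h2 : (2 : ℂ) * k = l ^ 2 - l := by exact_mod_cast hk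
  unfold quadGen
  rw [h1]
  push_cast
  linear_combination (-(D : ℂ) / 2) * h2

lemma quadGen_rep_zero {D : ℤ} (hD : D < 0) {x y : ℤ} (h : (x : ℂ) + y * quadGen D = 0) :
    x = 0 ∧ y = 0 := by
  have him := congrArg Complex.im h
  have hs : Real.sqrt (-(D : ℝ)) ≠ 0 := by
    rw [Real.sqrt_ne_zero']; simpa using hD
  have hy : y = 0 := by
    have : (quadGen D).im = Real.sqrt (-(D : ℝ)) / 2 := by
      simp [quadGen]
    rw [Complex.add_im, Complex.intCast_im, Complex.mul_im, this] at him
    simpa [hs] using him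
  subst hy
  exact ⟨by simpa using h, rfl⟩

lemma mem_quadOrder {D r : ℤ} (hD : D < 0) (hr : 4 * r = D ^ 2 - D) {z : ℂ} :
    z ∈ quadOrder D ↔ ∃ x y : ℤ, z = x + y * quadGen D := by
  have hgen : quadGen D ∈ quadOrder D := Algebra.subset_adjoin rfl
  constructor
  · intro hz
    refine Algebra.adjoin_induction ?_ ?_ ?_ ?_ hz
    · rintro _ rfl; exact ⟨0, 1, by simp [quadGen]⟩
    · intro x; exact ⟨x, 0, by simp⟩
    · rintro _ _ _ _ ⟨x, y, rfl⟩ ⟨x', y', rfl⟩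
      exact ⟨x + x', y + y', by push_cast; ring⟩
    · rintro _ _ _ _ ⟨x, y, rfl⟩ ⟨x', y', rfl⟩
      refine ⟨x * x' - r * (y * y'), x * y' + x' * y + D * (y * y'), ?_⟩
      push_cast
      linear_combination (y : ℂ) * y' * quadGen_sq hD hr
  · rintro ⟨x, y, rfl⟩
    exact add_mem (intCast_mem _ x) (mul_mem (intCast_mem _ y) hgen)

/-- The factors 3, 2, 1 are the orders of the unit group of B modulo ±1. The form is additive to
avoid subtraction in ℕ. -/
lemma classGroup_card_of_le {A B : Subalgebra ℤ ℂ} (hle : A ≤ B) {l : ℕ} (hl : l.Prime)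
    {D r : ℤ} {ω : ℂ} (hD : D < 0) (hr : 4 * r = D ^ 2 - D)
    (hB : ∀ z, z ∈ B ↔ ∃ x y : ℤ, z = x + y * ω)
    (hA : ∀ z, z ∈ A ↔ ∃ x y : ℤ, z = x + (l * y : ℤ) * ω)
    (hω : ω * ω = D * ω - r) (h0 : ∀ x y : ℤ, (x : ℂ) + y * ω = 0 → x = 0 ∧ y = 0) :
    Nat.card (ClassGroup A) * (if D = -3 then 3 else if D = -4 then 2 else 1) +
      Nat.card (ClassGroup B) * nroots l D r = Nat.card (ClassGroup B) * (l + 1) := by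
  let _ : Algebra A B := (Subalgebra.inclusion hle).toRingHom.toAlgebra
  have hmap : ∀ a : A, ((algebraMap A B a : B) : ℂ) = a := fun _ => rfl
  have : IsScalarTower A B ℂ := IsScalarTower.of_algebraMap_eq fun _ => rfl
  have hωB : ω ∈ B := (hB _).2 ⟨0, 1, by simp⟩
  have h : IsSuborder A l (⟨ω, hωB⟩ : B) D r := by
    constructor
    · rintro ⟨b, hb⟩
      obtain ⟨x, y, rfl⟩ := (hB _).1 hb
      exact ⟨x, y, Subtype.ext (by simp)⟩
    · intro x y hxy
      have := congrArg Subtype.val hxy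
      exact h0 x y (by simpa using this)
    · exact Subtype.ext (by simpa using hω)
    · intro x y
      constructor
      · rintro ⟨⟨a, ha⟩, hxy⟩
        have hxy' := congrArg Subtype.val hxy
        rw [hmap] at hxy'
        simp only [AddMemClass.coe_add, MulMemClass.coe_mul, SubringClass.coe_intCast] at hxy'
        obtain ⟨x', y', rfl⟩ := (hA _).1 ha
        have := (h0 (x' - x) (l * y' - y) (by push_cast; push_cast at hxy'; linear_combination hxy')).2
        exact ⟨y', by linarith⟩
      · rintro ⟨y', rfl⟩
        refine ⟨⟨x + (l * y' : ℤ) * ω, (hA _).2 ⟨x, y', rfl⟩⟩, Subtype.ext ?_⟩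
        rw [hmap]
        simp
  have h1 := h.card_classGroup_mul hl ℂ
  have h2 := h.card_units hl
  have h3 : Nat.card (IsSuborder.principal (B := B) A).range
      = (if D = -3 then 3 else if D = -4 then 2 else 1) := by
    split_ifs with e e
    · subst e
      obtain rfl : r = 3 := by omega
      exact h.card_principal_of_neg_three hl
    · subst e
      obtain rfl : r = 5 := by omega
      exact h.card_principal_of_neg_four hl
    · have : D ≠ -1 ∧ D ≠ -2 := by
        constructor <;> (rintro rfl; omega)
      exact h.card_principal_of_lt (by nlinarith [show D < -4 by omega])
  rw [← h3, h1, ← h2]; ring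

/-- The relation between the class numbers of the orders of discriminants `D` and `ℓ² D`. -/
theorem classNumber_sq_mul {l : ℕ} (hl : l.Prime) {D r : ℤ} (hD : D < 0)
    (hr : 4 * r = D ^ 2 - D) :
    classNumber ((l : ℤ) ^ 2 * D) * (if D = -3 then 3 else if D = -4 then 2 else 1) +
      classNumber D * nroots l D r = classNumber D * (l + 1) := by
  obtain ⟨k, hk⟩ : ∃ k : ℤ, 2 * k = (l : ℤ) ^ 2 - l := by
    obtain ⟨k, hk⟩ := Int.even_mul_succ_self ((l : ℤ) - 1)
    exact ⟨k, by linear_combination -hk⟩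
  have hl0 : (l : ℤ) ≠ 0 := by exact_mod_cast hl.ne_zero
  have hD' : (l : ℤ) ^ 2 * D < 0 := mul_neg_of_pos_of_neg (by positivity) hD
  obtain ⟨r', hr'⟩ : ∃ r' : ℤ, 4 * r' = ((l : ℤ) ^ 2 * D) ^ 2 - l ^ 2 * D :=
    ⟨l ^ 2 * r + k * D ^ 2 * k + k * l * D ^ 2, by
      linear_combination (l : ℤ) ^ 2 * hr + (2 * k + l ^ 2 + l) * D ^ 2 * hk⟩
  have hgen := quadGen_mul (D := D) l k hk
  have hA : ∀ z, z ∈ quadOrder ((l : ℤ) ^ 2 * D) ↔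
      ∃ x y : ℤ, z = x + (l * y : ℤ) * quadGen D := fun z => by
    rw [mem_quadOrder hD' hr', hgen]
    constructor
    · rintro ⟨x, y, rfl⟩
      exact ⟨x + y * (k * D), y, by push_cast; ring⟩
    · rintro ⟨x, y, rfl⟩
      exact ⟨x - y * (k * D), y, by push_cast; ring⟩
  refine classGroup_card_of_le (fun z hz => ?_) hl hD hr (fun z => mem_quadOrder hD hr) hA
    (quadGen_sq hD hr) (fun x y h => quadGen_rep_zero hD h)
  obtain ⟨x, y, rfl⟩ := (hA z).1 hz
  exact (mem_quadOrder hD hr).2 ⟨x, _, rfl⟩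

end EllipticTerm

/-! ### Weighted and Hurwitz class numbers when the discriminant is multiplied by ℓ². -/

namespace EllipticTerm

/-- Equal discriminants force p ≡ p' modulo 2, so the polynomials differ by an integer translation.
Nothing is divided by 2 in `ZMod l`, so ℓ = 2 is allowed. -/
lemma nroots_congr (l : ℕ) {p r p' r' : ℤ} (h : p ^ 2 - 4 * r = p' ^ 2 - 4 * r') :
    nroots l p r = nroots l p' r' := by
  obtain ⟨k, hk⟩ : (2 : ℤ) ∣ p' - p := by
    have h1 : (2 : ℤ) ∣ (p' - p) * (p' + p) := ⟨2 * (r' - r), by linear_combination -h⟩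
    rcases Int.prime_two.dvd_or_dvd h1 with h2 | h2 <;> omega
  have hr : r = k ^ 2 - p' * k + r' := by
    have : (4 : ℤ) * r = 4 * (k ^ 2 - p' * k + r') := by
      linear_combination -h + (p + p' - 2 * k) * (-hk)
    linarith
  have hp : p = p' - 2 * k := by linarith
  refine Nat.card_congr (Equiv.subtypeEquiv (Equiv.addRight (k : ZMod l)) fun s => ?_)
  rw [Equiv.coe_addRight, hr, hp]
  push_cast
  ring_nf

lemma nroots_mul {l : ℕ} {m : ℕ} (hm : m.Coprime l) (p r : ℤ) :
    nroots l (p * m) (r * m ^ 2) = nroots l p r := by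
  let u := ZMod.unitOfCoprime m hm
  have hu : ((u : (ZMod l)ˣ) : ZMod l) = m := ZMod.coe_unitOfCoprime m hm
  refine (Nat.card_congr (Equiv.subtypeEquiv (Units.mulLeft u) fun s => ?_)).symm
  rw [Units.mulLeft_apply, hu]
  push_cast
  rw [show (m * s : ZMod l) ^ 2 - p * m * (m * s) + r * m ^ 2 = (s ^ 2 - p * s + r) * m ^ 2 by ring,
    ← hu]
  rw [← Units.val_pow_eq_pow_val, Units.mul_left_eq_zero]

lemma nroots_eq_one_of_dvd {l : ℕ} (hl : l.Prime) {p r : ℤ} (hp : (l : ℤ) ∣ p) (hr : (l : ℤ) ∣ r) :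
    nroots l p r = 1 := by
  have : Fact l.Prime := ⟨hl⟩
  rw [← ZMod.intCast_zmod_eq_zero_iff_dvd] at hp hr
  rw [nroots, hp, hr]
  simp

lemma exists_disc_iff {D : ℤ} : (D % 4 = 0 ∨ D % 4 = 1) ↔ ∃ p r : ℤ, D = p ^ 2 - 4 * r := by
  constructor
  · rintro (h | h)
    · exact ⟨0, -(D / 4), by omega⟩
    · exact ⟨1, -(D / 4), by omega⟩
  · rintro ⟨p, r, rfl⟩
    rcases Int.even_or_odd' p with ⟨k, rfl | rfl⟩
    · left; ring_nf; omega
    · right; ring_nf; omega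

lemma hw_eq_zero {D : ℤ} (h : ¬ (D % 4 = 0 ∨ D % 4 = 1)) : hw D = 0 := by
  have h3 : D ≠ -3 := by rintro rfl; exact h (by decide)
  have h4 : D ≠ -4 := by rintro rfl; exact h (by decide)
  rw [hw, if_neg h3, if_neg h4, if_neg fun hc => h hc.2]

/-- The denominators 3 and 2 in `hw` cancel the unit factors, which makes the relation uniform in D;
ℓ²D is too small to be -3 or -4. -/
theorem hw_sq_mul {l : ℕ} (hl : l.Prime) {p r : ℤ} (hD : p ^ 2 - 4 * r < 0) :
    hw ((l : ℤ) ^ 2 * (p ^ 2 - 4 * r)) = (l + 1 - nroots l p r) * hw (p ^ 2 - 4 * r) := by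
  have hdisc := exists_disc_iff.2 ⟨p, r, rfl⟩
  have hdisc' := exists_disc_iff (D := (l : ℤ) ^ 2 * (p ^ 2 - 4 * r)).2
    ⟨l * p, l ^ 2 * r, by ring⟩
  obtain ⟨R, hR⟩ : ∃ R : ℤ, 4 * R = (p ^ 2 - 4 * r) ^ 2 - (p ^ 2 - 4 * r) := by
    rcases Int.even_or_odd' p with ⟨c, rfl | rfl⟩
    · exact ⟨4 * (c ^ 2 - r) ^ 2 - (c ^ 2 - r), by ring⟩
    · exact ⟨(4 * (c ^ 2 + c - r) + 1) * (c ^ 2 + c - r), by ring⟩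
  have hn : nroots l (p ^ 2 - 4 * r) R = nroots l p r :=
    nroots_congr l (by linear_combination -hR)
  have key := classNumber_sq_mul hl hD hR
  rw [hn] at key
  generalize p ^ 2 - 4 * r = D at *
  have h4 : (4 : ℤ) ≤ (l : ℤ) ^ 2 := by
    have : (2 : ℤ) ≤ l := by exact_mod_cast hl.two_le
    nlinarith
  have hlt : (l : ℤ) ^ 2 * D < -4 := by
    have : D ≤ -3 := by omega
    nlinarith
  have e1 : hw ((l : ℤ) ^ 2 * D) = classNumber ((l : ℤ) ^ 2 * D) := by
    rw [hw, if_neg (by omega), if_neg (by omega), if_pos ⟨by omega, hdisc'⟩]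
  have key' := congrArg (Nat.cast : ℕ → ℚ) key
  rw [e1, hw]
  split_ifs at key' ⊢ with h1 h2 h3
  · push_cast at key'; linear_combination key' / 3
  · push_cast at key'; linear_combination key' / 2
  · push_cast at key'; linear_combination key'
  · exact absurd ⟨hD, hdisc⟩ h3

lemma mem_sqDivisors {D : ℤ} (hD : D ≠ 0) {m : ℕ} :
    m ∈ sqDivisors D ↔ 0 < m ∧ (m : ℤ) ^ 2 ∣ D := by
  rw [sqDivisors, Finset.mem_filter, Finset.mem_Icc]
  constructor
  · rintro ⟨⟨h1, _⟩, h2⟩; exact ⟨h1, h2⟩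
  · rintro ⟨h1, h2⟩
    refine ⟨⟨h1, ?_⟩, h2⟩
    have h3 : m ∣ D.natAbs := Int.natCast_dvd.1 ((dvd_pow_self _ two_ne_zero).trans h2)
    exact Nat.le_of_dvd (Int.natAbs_pos.2 hD) h3

lemma hurwitzDiv_eq_sum {D : ℤ} (hD : D ≠ 0) {n : ℕ} (hn : 0 < n) :
    hurwitzDiv D n = ∑ m ∈ (sqDivisors D).filter (n ∣ ·), hw (D / (m : ℤ) ^ 2) := by
  have hn2 : ((n : ℤ) ^ 2) ≠ 0 := by positivity
  rw [hurwitzDiv]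
  split_ifs with h
  · obtain ⟨E, rfl⟩ := h
    have hE : E ≠ 0 := right_ne_zero_of_mul hD
    rw [Int.mul_ediv_cancel_left _ hn2, hurwitz]
    refine Finset.sum_bij' (fun m _ => n * m) (fun m _ => m / n) ?_ ?_ ?_ ?_ ?_
    · intro m hm
      rw [mem_sqDivisors hE] at hm
      rw [Finset.mem_filter, mem_sqDivisors hD]
      refine ⟨⟨Nat.mul_pos hn hm.1, ?_⟩, dvd_mul_right _ _⟩
      push_cast; rw [mul_pow]; exact mul_dvd_mul_left _ hm.2
    · intro m hm
      rw [Finset.mem_filter, mem_sqDivisors hD] at hm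
      obtain ⟨⟨h1, h2⟩, k, rfl⟩ := hm
      rw [Nat.mul_div_cancel_left _ hn, mem_sqDivisors hE]
      push_cast at h2
      rw [mul_pow] at h2
      exact ⟨Nat.pos_of_mul_pos_left h1, (mul_dvd_mul_iff_left hn2).1 h2⟩
    · intro m _; exact Nat.mul_div_cancel_left _ hn
    · intro m hm
      exact Nat.mul_div_cancel' (Finset.mem_filter.1 hm).2
    · intro m _
      push_cast
      rw [mul_pow, Int.mul_ediv_mul_of_pos _ _ (by positivity)]
  · rw [Finset.sum_eq_zero]
    intro m hm
    rw [Finset.mem_filter, mem_sqDivisors hD] at hm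
    obtain ⟨⟨h1, h2⟩, k, rfl⟩ := hm
    refine absurd ((Dvd.intro ((k : ℤ) ^ 2) ?_).trans h2) h
    push_cast; ring

/-- `H(D / ℓ^(2 i))`. -/
noncomputable def hurwitzPow (l : ℕ) (D : ℤ) (i : ℕ) : ℚ := hurwitzDiv D (l ^ i)

lemma hurwitzPow_succ {l : ℕ} (hl : l.Prime) (D : ℤ) (i : ℕ) :
    hurwitzPow l ((l : ℤ) ^ 2 * D) (i + 1) = hurwitzPow l D i := by
  have h0 : (l : ℤ) ^ 2 ≠ 0 := pow_ne_zero _ (by exact_mod_cast hl.ne_zero)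
  rw [hurwitzPow, hurwitzPow, hurwitzDiv, hurwitzDiv]
  have e : ((l ^ (i + 1) : ℕ) : ℤ) ^ 2 = (l : ℤ) ^ 2 * ((l ^ i : ℕ) : ℤ) ^ 2 := by push_cast; ring
  simp only [e, mul_dvd_mul_iff_left h0]
  rw [Int.mul_ediv_mul_of_pos _ _ (by positivity)]

lemma hurwitzPow_add {l : ℕ} (hl : l.Prime) (D : ℤ) (e i : ℕ) :
    hurwitzPow l ((l : ℤ) ^ (2 * e) * D) (e + i) = hurwitzPow l D i := by
  induction e generalizing i with
  | zero => simp
  | succ e ih =>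
    rw [show (l : ℤ) ^ (2 * (e + 1)) * D = (l : ℤ) ^ 2 * ((l : ℤ) ^ (2 * e) * D) by ring,
      show e + 1 + i = (e + i) + 1 by ring, hurwitzPow_succ hl, ih]

lemma exists_disc_of_hurwitzPow_ne_zero {l : ℕ} {D : ℤ} (hD : D ≠ 0) (hl : l.Prime) {i : ℕ}
    (h : hurwitzPow l D i ≠ 0) : ∃ p r : ℤ, D = (l : ℤ) ^ (2 * i) * (p ^ 2 - 4 * r) := by
  rw [hurwitzPow, hurwitzDiv_eq_sum hD (pow_pos hl.pos i)] at h
  obtain ⟨m, hm, hne⟩ := Finset.exists_ne_zero_of_sum_ne_zero h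
  rw [Finset.mem_filter, mem_sqDivisors hD] at hm
  obtain ⟨⟨h1, E, rfl⟩, k, rfl⟩ := hm
  rw [Int.mul_ediv_cancel_left _ (by positivity)] at hne
  obtain ⟨p, r, rfl⟩ := exists_disc_iff.1 (not_imp_comm.1 hw_eq_zero hne)
  exact ⟨k * p, k ^ 2 * r, by push_cast; ring⟩

lemma hurwitzPow_zero_sub_one {l : ℕ} (hl : l.Prime) {D : ℤ} (hD : D ≠ 0) :
    hurwitzPow l D 0 - hurwitzPow l D 1 =
      ∑ m ∈ (sqDivisors D).filter (¬ l ∣ ·), hw (D / (m : ℤ) ^ 2) := by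
  rw [hurwitzPow, hurwitzPow, pow_zero, pow_one, hurwitzDiv_eq_sum hD one_pos,
    hurwitzDiv_eq_sum hD hl.pos, Finset.filter_true_of_mem fun m _ => one_dvd m,
    ← Finset.sum_filter_add_sum_filter_not (sqDivisors D) (l ∣ ·)]
  ring

/-- H(D) - H(D/ℓ²) keeps exactly the m prime to ℓ. For these `nroots` is the same for D/m² as for D,
so `hw_sq_mul` applies termwise with a common factor. -/
theorem hurwitzPow_sq_mul {l : ℕ} (hl : l.Prime) {p r : ℤ} (hD : p ^ 2 - 4 * r < 0) :
    hurwitzPow l ((l : ℤ) ^ 2 * (p ^ 2 - 4 * r)) 0 - hurwitzPow l ((l : ℤ) ^ 2 * (p ^ 2 - 4 * r)) 1 =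
      (l + 1 - nroots l p r) *
        (hurwitzPow l (p ^ 2 - 4 * r) 0 - hurwitzPow l (p ^ 2 - 4 * r) 1) := by
  have hl0 : (l : ℤ) ≠ 0 := by exact_mod_cast hl.ne_zero
  have hD' : (l : ℤ) ^ 2 * (p ^ 2 - 4 * r) ≠ 0 := mul_ne_zero (pow_ne_zero _ hl0) hD.ne
  rw [hurwitzPow_zero_sub_one hl hD', hurwitzPow_zero_sub_one hl hD.ne, Finset.mul_sum]
  have hcop : ∀ m : ℕ, ¬ l ∣ m → m.Coprime l := fun m hm =>
    ((Nat.Prime.coprime_iff_not_dvd hl).2 hm).symm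
  have hset : (sqDivisors ((l : ℤ) ^ 2 * (p ^ 2 - 4 * r))).filter (¬ l ∣ ·) =
      (sqDivisors (p ^ 2 - 4 * r)).filter (¬ l ∣ ·) := by
    ext m
    rw [Finset.mem_filter, Finset.mem_filter, mem_sqDivisors hD', mem_sqDivisors hD.ne]
    constructor
    · rintro ⟨⟨h1, h2⟩, h3⟩
      refine ⟨⟨h1, ?_⟩, h3⟩
      have : IsCoprime ((m : ℤ) ^ 2) ((l : ℤ) ^ 2) :=
        (Nat.isCoprime_iff_coprime.2 (hcop m h3)).pow
      exact this.dvd_of_dvd_mul_left h2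
    · rintro ⟨⟨h1, h2⟩, h3⟩
      exact ⟨⟨h1, h2.mul_left _⟩, h3⟩
  rw [hset]
  refine Finset.sum_congr rfl fun m hm => ?_
  rw [Finset.mem_filter, mem_sqDivisors hD.ne] at hm
  obtain ⟨⟨hm0, E, hE⟩, hlm⟩ := hm
  have hm2 : (0 : ℤ) < (m : ℤ) ^ 2 := by positivity
  rw [hE, show (l : ℤ) ^ 2 * ((m : ℤ) ^ 2 * E) = (m : ℤ) ^ 2 * ((l : ℤ) ^ 2 * E) by ring,
    Int.mul_ediv_cancel_left _ hm2.ne', Int.mul_ediv_cancel_left _ hm2.ne']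
  have hEneg : E < 0 := by nlinarith
  by_cases hdisc : E % 4 = 0 ∨ E % 4 = 1
  · obtain ⟨p', r', rfl⟩ := exists_disc_iff.1 hdisc
    rw [hw_sq_mul hl hEneg, ← nroots_mul (hcop m hlm) p' r',
      nroots_congr l (p' := p) (r' := r) (by linear_combination -hE)]
  · rw [hw_eq_zero hdisc, mul_zero]
    refine hw_eq_zero fun hdisc' => hdisc ?_
    -- One of ℓ and m is odd, and odd squares are 1 modulo 4. So E is congruent modulo 4 to ℓ²E or
    -- to m²E, both of which are 0 or 1 modulo 4 here.
    have hodd : ∀ a : ℤ, ¬ (2 : ℤ) ∣ a → ∃ b, a ^ 2 = 4 * b + 1 := fun a ha => by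
      obtain ⟨c, rfl⟩ := Int.not_even_iff_odd.1 (fun h => ha h.two_dvd)
      exact ⟨c ^ 2 + c, by ring⟩
    have hl2 : ¬ (2 : ℤ) ∣ l ∨ ¬ (2 : ℤ) ∣ m := by
      by_contra hcon
      push Not at hcon
      have h2l : 2 ∣ l := by exact_mod_cast hcon.1
      have : l = 2 := ((Nat.prime_dvd_prime_iff_eq Nat.prime_two hl).1 h2l).symm
      subst this
      exact hlm (by exact_mod_cast hcon.2)
    have hdisc2 := exists_disc_iff (D := (m : ℤ) ^ 2 * E).2 ⟨p, r, hE.symm⟩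
    rcases hl2 with h2 | h2
    · obtain ⟨b, hb⟩ := hodd _ h2
      rw [hb, show (4 * b + 1) * E = E + 4 * (b * E) by ring] at hdisc'
      omega
    · obtain ⟨b, hb⟩ := hodd _ h2
      rw [hb, show (4 * b + 1) * E = E + 4 * (b * E) by ring] at hdisc2
      omega

/-- The differences `H(D / ℓ^(2κ)) - H(D / ℓ^(2κ+2))` below level `e`. -/
lemma hurwitzPow_sub_of_lt {l : ℕ} (hl : l.Prime) {p r : ℤ} (hD : p ^ 2 - 4 * r < 0) {e κ : ℕ}
    (hκ : κ < e) {Δ : ℤ} (hΔ : Δ = (l : ℤ) ^ (2 * e) * (p ^ 2 - 4 * r)) :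
    hurwitzPow l Δ κ - hurwitzPow l Δ (κ + 1) =
      (l : ℚ) ^ (e - 1 - κ) * (l + 1 - nroots l p r) *
        (hurwitzPow l Δ e - hurwitzPow l Δ (e + 1)) := by
  have hl0 : (0 : ℤ) < l := by exact_mod_cast hl.pos
  induction e generalizing p r with
  | zero => omega
  | succ e ih =>
    have h1 : hurwitzPow l Δ e - hurwitzPow l Δ (e + 1) =
        (l + 1 - nroots l p r) * (hurwitzPow l Δ (e + 1) - hurwitzPow l Δ (e + 1 + 1)) := by
      have a1 := hurwitzPow_add hl (p ^ 2 - 4 * r) (e + 1) 0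
      have a2 := hurwitzPow_add hl (p ^ 2 - 4 * r) (e + 1) 1
      have a3 := hurwitzPow_add hl ((l : ℤ) ^ 2 * (p ^ 2 - 4 * r)) e 0
      have a4 := hurwitzPow_add hl ((l : ℤ) ^ 2 * (p ^ 2 - 4 * r)) e 1
      rw [show (l : ℤ) ^ (2 * e) * ((l : ℤ) ^ 2 * (p ^ 2 - 4 * r)) = Δ by rw [hΔ]; ring] at a3 a4
      rw [← hΔ] at a1 a2
      have := hurwitzPow_sq_mul hl hD
      rw [← a1, ← a2, ← a3, ← a4] at this
      exact this
    -- Below the first step the polynomial has both coefficients divisible by ℓ, so `nroots` is 1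
    -- and each further step multiplies by ℓ.
    rcases Nat.lt_succ_iff_lt_or_eq.1 hκ with h | rfl
    · have hneg : ((l : ℤ) * p) ^ 2 - 4 * (l ^ 2 * r) < 0 := by
        have : ((l : ℤ) * p) ^ 2 - 4 * (l ^ 2 * r) = l ^ 2 * (p ^ 2 - 4 * r) := by ring
        rw [this]; exact mul_neg_of_pos_of_neg (by positivity) hD
      have h2 := ih hneg h (by rw [hΔ]; ring)
      rw [nroots_eq_one_of_dvd hl (dvd_mul_right _ _)
        ((dvd_pow_self _ two_ne_zero).mul_right _)] at h2
      rw [h2, h1, show e + 1 - 1 - κ = (e - 1 - κ) + 1 by omega]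
      push_cast; ring
    · rw [h1, show κ + 1 - 1 - κ = 0 by omega]; ring

/-- Summation over `sqDivisors D` of a function of the truncated valuation. -/
lemma sum_sqDivisors_mul {l : ℕ} (hl : l.Prime) {D : ℤ} (hD : D ≠ 0) (Φ : ℕ → ℚ) (N : ℕ) :
    ∑ m ∈ sqDivisors D, hw (D / (m : ℤ) ^ 2) * Φ (min (padicValNat l m) N) =
      ∑ κ ∈ Finset.range N, Φ κ * (hurwitzPow l D κ - hurwitzPow l D (κ + 1)) +
        Φ N * hurwitzPow l D N := by
  have : Fact l.Prime := ⟨hl⟩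
  induction N with
  | zero =>
    rw [hurwitzPow, pow_zero, hurwitzDiv_eq_sum hD one_pos]
    simp [Finset.mul_sum, mul_comm]
  | succ N ih =>
    -- Raising the truncation from N to N + 1 only affects the m divisible by ℓ^(N+1).
    have h1 : ∑ m ∈ sqDivisors D, hw (D / (m : ℤ) ^ 2) * Φ (min (padicValNat l m) (N + 1)) =
        ∑ m ∈ sqDivisors D, hw (D / (m : ℤ) ^ 2) * Φ (min (padicValNat l m) N) +
          (Φ (N + 1) - Φ N) * hurwitzPow l D (N + 1) := by
      rw [hurwitzPow, hurwitzDiv_eq_sum hD (pow_pos hl.pos _), Finset.mul_sum, Finset.sum_filter,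
        ← Finset.sum_add_distrib]
      refine Finset.sum_congr rfl fun m hm => ?_
      have hm0 : m ≠ 0 := ((mem_sqDivisors hD).1 hm).1.ne'
      simp only [padicValNat_dvd_iff_le hm0]
      split_ifs with h
      · rw [min_eq_right h, min_eq_right (by omega)]; ring
      · rw [min_eq_left (by omega), min_eq_left (by omega), add_zero]
    rw [h1, ih, Finset.sum_range_succ]; ring

end EllipticTerm

/-! ### Counting residue classes of approximate roots of quadratics. -/

namespace EllipticTerm

lemma dvd_of_eq_right {a b c : ℤ} (h : a ∣ b) (e : b = c) : a ∣ c := e ▸ h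

/-- The number of residue classes modulo `M` which meet `X`. -/
noncomputable def classCount (M : ℕ) (X : Set ℤ) : ℕ := ((Int.cast : ℤ → ZMod M) '' X).ncard

lemma intCast_zmod_eq_iff {M : ℕ} {x y : ℤ} : (x : ZMod M) = y ↔ (M : ℤ) ∣ x - y := by
  rw [← ZMod.intCast_zmod_eq_zero_iff_dvd]; push_cast; rw [sub_eq_zero]

lemma classCount_image {M M' : ℕ} (X : Set ℤ) (f : ℤ → ℤ)
    (hf : ∀ x y, (M' : ℤ) ∣ f x - f y ↔ (M : ℤ) ∣ x - y) :
    classCount M' (f '' X) = classCount M X := by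
  symm
  have hch : ∀ a ∈ (Int.cast : ℤ → ZMod M) '' X, ∃ x ∈ X, (x : ZMod M) = a := fun a ha => ha
  choose g hgX hg using hch
  refine Set.ncard_congr (fun a ha => ((f (g a ha) : ℤ) : ZMod M')) ?_ ?_ ?_
  · intro a ha
    exact ⟨_, ⟨_, hgX a ha, rfl⟩, rfl⟩
  · intro a b ha hb h
    rw [intCast_zmod_eq_iff, hf, ← intCast_zmod_eq_iff, hg, hg] at h
    exact h
  · rintro _ ⟨_, ⟨x, hx, rfl⟩, rfl⟩
    refine ⟨x, ⟨x, hx, rfl⟩, ?_⟩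
    rw [intCast_zmod_eq_iff, hf, ← intCast_zmod_eq_iff]
    exact hg _ _

/-- X is a union of classes modulo M, and each splits into k classes modulo M k. -/
lemma classCount_mul {M k : ℕ} (hM : 0 < M) (hk : 0 < k) (X : Set ℤ)
    (hX : ∀ x z, x ∈ X → x + M * z ∈ X) : classCount (M * k) X = k * classCount M X := by
  have : NeZero M := ⟨hM.ne'⟩
  have : NeZero k := ⟨hk.ne'⟩
  have hX' : ∀ {x y : ℤ}, y ∈ X → (x : ZMod M) = y → x ∈ X := fun {x y} hy hxy => by
    obtain ⟨z, hz⟩ := intCast_zmod_eq_iff.1 hxy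
    rw [show x = y + M * z by linarith]; exact hX y z hy
  let g : ZMod M × ZMod k → ZMod (M * k) := fun c => ((c.1.val + M * c.2.val : ℤ) : ZMod (M * k))
  have himg : (Int.cast : ℤ → ZMod (M * k)) '' X =
      g '' (((Int.cast : ℤ → ZMod M) '' X) ×ˢ (Set.univ : Set (ZMod k))) := by
    ext c
    constructor
    · rintro ⟨x, hx, rfl⟩
      have h1 : (x : ZMod M) = ((x : ZMod M).val : ℤ) := by push_cast; rw [ZMod.natCast_zmod_val]
      obtain ⟨z, hz⟩ := intCast_zmod_eq_iff.1 h1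
      have h2 : (z : ZMod k) = ((z : ZMod k).val : ℤ) := by push_cast; rw [ZMod.natCast_zmod_val]
      obtain ⟨y, hy⟩ := intCast_zmod_eq_iff.1 h2
      refine ⟨(x, z), ⟨⟨x, hx, rfl⟩, trivial⟩, ?_⟩
      rw [eq_comm]
      refine intCast_zmod_eq_iff.2 ⟨y, ?_⟩
      push_cast
      linear_combination hz + M * hy
    · rintro ⟨⟨_, j⟩, ⟨⟨x, hx, rfl⟩, -⟩, rfl⟩
      refine ⟨_, hX' hx ?_, rfl⟩
      push_cast
      rw [ZMod.natCast_zmod_val]; simp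
  have hinj : Set.InjOn g (((Int.cast : ℤ → ZMod M) '' X) ×ˢ (Set.univ : Set (ZMod k))) := by
    rintro ⟨a, j⟩ - ⟨b, j'⟩ - h
    have h1 := intCast_zmod_eq_iff.1 h
    dsimp only at h1
    have h2 : a = b := by
      have h3 : (M : ℤ) ∣ (a.val : ℤ) - b.val := by
        have h4 := (Dvd.intro (k : ℤ) (by push_cast; rfl)).trans h1
        have h5 : (M : ℤ) ∣ M * ((j.val : ℤ) - j'.val) := dvd_mul_right _ _
        have := dvd_sub h4 h5
        exact dvd_of_eq_right this (by ring)
      rw [← intCast_zmod_eq_iff] at h3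
      push_cast at h3
      rwa [ZMod.natCast_zmod_val, ZMod.natCast_zmod_val] at h3
    subst h2
    have h3 : (k : ℤ) ∣ (j.val : ℤ) - j'.val := by
      have h4 : ((M : ℤ) * k) ∣ M * ((j.val : ℤ) - j'.val) := by
        push_cast at h1; exact dvd_of_eq_right h1 (by ring)
      exact (mul_dvd_mul_iff_left (by exact_mod_cast hM.ne')).1 h4
    rw [← intCast_zmod_eq_iff] at h3
    push_cast at h3
    rw [ZMod.natCast_zmod_val, ZMod.natCast_zmod_val] at h3
    rw [h3]
  rw [classCount, himg, hinj.ncard_image, Set.ncard_prod, Set.ncard_univ,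
    Nat.card_zmod, mul_comm, classCount]

lemma classCount_univ {M : ℕ} : classCount M Set.univ = M := by
  rw [classCount, Set.image_univ, ZMod.intCast_surjective.range_eq, Set.ncard_univ, Nat.card_zmod]

lemma classCount_empty {M : ℕ} : classCount M ∅ = 0 := by
  rw [classCount, Set.image_empty, Set.ncard_empty]

/-- The number of classes modulo `ℓ^k` of the solutions of `y² + u y + w ≡ 0` modulo `ℓ^s`. -/
noncomputable def quadCount (l : ℕ) (u w : ℤ) (k s : ℕ) : ℕ :=
  classCount (l ^ k) {y | (l : ℤ) ^ s ∣ y ^ 2 + u * y + w}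

lemma nroots_eq_quadCount (l : ℕ) (u w : ℤ) : nroots l u w = quadCount l u w 1 1 := by
  have h1 : nroots l u w = nroots l (-u) w := nroots_congr l (by ring)
  rw [h1, nroots, quadCount, classCount, pow_one, pow_one, ← Nat.card_coe_set_eq]
  refine Nat.card_congr (Equiv.subtypeEquivRight fun s => ?_)
  obtain ⟨y, rfl⟩ := ZMod.intCast_surjective s
  have key : ∀ y : ℤ, (y : ZMod l) ^ 2 - ((-u : ℤ) : ZMod l) * y + w = 0 ↔
      (l : ℤ) ∣ y ^ 2 + u * y + w := fun y => by
    rw [← ZMod.intCast_zmod_eq_zero_iff_dvd]; push_cast; ring_nf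
  constructor
  · intro h
    exact ⟨y, (key y).1 h, rfl⟩
  · rintro ⟨y', h, e⟩
    rw [← e]
    exact (key y').2 h

lemma quadCount_zero (l : ℕ) (u w : ℤ) (k : ℕ) : quadCount l u w k 0 = l ^ k := by
  simp [quadCount, classCount_univ]

lemma quadCount_translate (l : ℕ) (u w ρ : ℤ) (k s : ℕ) :
    quadCount l (2 * ρ + u) (ρ ^ 2 + u * ρ + w) k s = quadCount l u w k s := by
  rw [quadCount, quadCount, ← classCount_image (M' := l ^ k) _ (fun y => ρ + y) (fun x y => by ring_nf)]
  congr 1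
  ext y
  simp only [Set.mem_image, Set.mem_ofPred_eq]
  constructor
  · rintro ⟨z, hz, rfl⟩
    exact dvd_of_eq_right hz (by ring)
  · intro hy
    exact ⟨y - ρ, by exact dvd_of_eq_right hy (by ring), by ring⟩

lemma dvd_of_dvd_quad {l : ℕ} (hl : l.Prime) {u w y : ℤ} (hu : (l : ℤ) ∣ u) (hw : (l : ℤ) ∣ w)
    (hy : (l : ℤ) ∣ y ^ 2 + u * y + w) : (l : ℤ) ∣ y := by
  have h1 : (l : ℤ) ∣ y ^ 2 := by
    have := dvd_sub hy (dvd_add (hu.mul_right y) hw)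
    exact dvd_of_eq_right this (by ring)
  exact (Nat.prime_iff_prime_int.1 hl).dvd_of_dvd_pow h1

/-- A root is divisible by ℓ, and y = ℓz takes a factor ℓ² out of the polynomial. -/
lemma quadCount_scale {l : ℕ} (hl : l.Prime) (u w : ℤ) (k s : ℕ) :
    quadCount l (l * u) (l ^ 2 * w) (k + 1) (s + 2) = quadCount l u w k s := by
  have hl0 : (l : ℤ) ≠ 0 := by exact_mod_cast hl.ne_zero
  rw [quadCount, quadCount, ← classCount_image (M := l ^ k) (M' := l ^ (k + 1)) _ (fun y => l * y) (fun x y => by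
    push_cast
    rw [← mul_sub, pow_succ', mul_dvd_mul_iff_left hl0])]
  congr 1
  ext y
  simp only [Set.mem_image, Set.mem_ofPred_eq]
  have key : ∀ z : ℤ, (l : ℤ) ^ (s + 2) ∣ (l * z) ^ 2 + l * u * (l * z) + l ^ 2 * w ↔
      (l : ℤ) ^ s ∣ z ^ 2 + u * z + w := fun z => by
    rw [show ((l : ℤ) * z) ^ 2 + l * u * (l * z) + l ^ 2 * w = l ^ 2 * (z ^ 2 + u * z + w) by ring,
      pow_add, mul_comm ((l : ℤ) ^ s), mul_dvd_mul_iff_left (pow_ne_zero 2 hl0)]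
  constructor
  · intro hy
    obtain ⟨z, rfl⟩ := dvd_of_dvd_quad hl (dvd_mul_right _ u)
      ((dvd_pow_self (l : ℤ) two_ne_zero).mul_right w)
      ((dvd_pow_self (l : ℤ) (by omega : s + 2 ≠ 0)).trans hy)
    exact ⟨z, (key z).1 hy, rfl⟩
  · rintro ⟨z, hz, rfl⟩
    exact (key z).2 hz

lemma quadCount_one_one {l : ℕ} (hl : l.Prime) {u w : ℤ} (hu : (l : ℤ) ∣ u) (hw : (l : ℤ) ∣ w) :
    quadCount l u w 1 1 = 1 := by
  rw [← nroots_eq_quadCount, nroots_eq_one_of_dvd hl hu hw]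

lemma quadCount_add {l : ℕ} (hl : l.Prime) (u w : ℤ) (k j : ℕ) :
    quadCount l u w (k + j) k = l ^ j * quadCount l u w k k := by
  rw [quadCount, quadCount, pow_add, classCount_mul (pow_pos hl.pos k) (pow_pos hl.pos j)]
  intro x z hx
  simp only [Set.mem_ofPred_eq] at hx ⊢
  push_cast
  have := dvd_add hx (dvd_mul_right ((l : ℤ) ^ k) (z * (2 * x + l ^ k * z + u)))
  exact dvd_of_eq_right this (by ring)

lemma quadCount_succ {l : ℕ} (hl : l.Prime) (u w : ℤ) (k : ℕ) :
    quadCount l u w (k + 1) k = l * quadCount l u w k k := by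
  rw [quadCount_add hl, pow_one]

lemma quadCount_eq_zero {l : ℕ} {u w : ℤ} {s : ℕ} (h : ∀ y : ℤ, ¬ (l : ℤ) ^ s ∣ y ^ 2 + u * y + w)
    (k : ℕ) : quadCount l u w k s = 0 := by
  rw [quadCount, ← classCount_empty]
  congr 1
  exact Set.eq_empty_of_forall_notMem h

section Linear

variable {l : ℕ} {u v w : ℤ}

lemma dvd_sub_of_dvd_linear (hl : l.Prime) (hu : ¬ (l : ℤ) ∣ u) (hv : (l : ℤ) ∣ v) {j : ℕ}
    {z z' : ℤ} (h : (l : ℤ) ^ j ∣ (w + u * z + v * z ^ 2) - (w + u * z' + v * z' ^ 2)) :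
    (l : ℤ) ^ j ∣ z - z' := by
  have hcop : IsCoprime ((l : ℤ) ^ j) (u + v * (z + z')) := by
    refine IsCoprime.pow_left ?_
    rw [(Nat.prime_iff_prime_int.1 hl).coprime_iff_not_dvd, dvd_add_left (hv.mul_right _)]
    exact hu
  refine hcop.dvd_of_dvd_mul_left ?_
  exact dvd_of_eq_right h (by ring)

/-- By `dvd_sub_of_dvd_linear` the polynomial is injective on a finite ring, hence surjective; this
replaces an iterative Hensel lifting. -/
lemma exists_dvd_linear (hl : l.Prime) (hu : ¬ (l : ℤ) ∣ u) (hv : (l : ℤ) ∣ v) (w : ℤ) (j : ℕ) :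
    ∃ z : ℤ, (l : ℤ) ^ j ∣ w + u * z + v * z ^ 2 := by
  have : NeZero (l ^ j) := ⟨pow_ne_zero j hl.ne_zero⟩
  have hinj : Function.Injective (fun z : ZMod (l ^ j) => (w : ZMod (l ^ j)) + u * z + v * z ^ 2) := by
    intro a b hab
    obtain ⟨a, rfl⟩ := ZMod.intCast_surjective a
    obtain ⟨b, rfl⟩ := ZMod.intCast_surjective b
    dsimp only at hab
    have h1 : ((w + u * a + v * a ^ 2 : ℤ) : ZMod (l ^ j)) = (w + u * b + v * b ^ 2 : ℤ) := by
      push_cast; exact hab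
    rw [intCast_zmod_eq_iff] at h1 ⊢
    push_cast at h1 ⊢
    exact dvd_sub_of_dvd_linear hl hu hv h1
  obtain ⟨z, hz⟩ := (Finite.injective_iff_surjective.1 hinj) 0
  obtain ⟨z, rfl⟩ := ZMod.intCast_surjective z
  refine ⟨z, ?_⟩
  have := (ZMod.intCast_zmod_eq_zero_iff_dvd (w + u * z + v * z ^ 2) (l ^ j)).1 (by
    push_cast; exact hz)
  exact_mod_cast this

/-- The number of classes modulo `ℓ^α` on which a polynomial with an invertible linear coefficient
vanishes modulo `ℓ^j`. -/
lemma classCount_linear (hl : l.Prime) (hu : ¬ (l : ℤ) ∣ u) (hv : (l : ℤ) ∣ v) (w : ℤ) {j α : ℕ}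
    (hj : j ≤ α) : classCount (l ^ α) {z | (l : ℤ) ^ j ∣ w + u * z + v * z ^ 2} = l ^ (α - j) := by
  obtain ⟨z₀, hz₀⟩ := exists_dvd_linear hl hu hv w j
  have hset : {z : ℤ | (l : ℤ) ^ j ∣ w + u * z + v * z ^ 2} = {z | ((l ^ j : ℕ) : ℤ) ∣ z - z₀} := by
    ext z
    simp only [Set.mem_ofPred_eq]
    push_cast
    constructor
    · intro hz
      exact dvd_sub_of_dvd_linear hl hu hv (dvd_sub hz hz₀)
    · intro hz
      have := dvd_add hz₀ (hz.mul_right (u + v * (z + z₀)))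
      exact dvd_of_eq_right this (by ring)
  have e : l ^ α = l ^ j * l ^ (α - j) := by rw [← pow_add]; congr 1; omega
  rw [hset, e, classCount_mul (pow_pos hl.pos _) (pow_pos hl.pos _)]
  · have : classCount (l ^ j) {z | ((l ^ j : ℕ) : ℤ) ∣ z - z₀} = 1 := by
      rw [classCount, Set.ncard_eq_one]
      refine ⟨(z₀ : ZMod (l ^ j)), ?_⟩
      ext c
      constructor
      · rintro ⟨z, hz, rfl⟩
        exact intCast_zmod_eq_iff.2 hz
      · rintro rfl
        exact ⟨z₀, by simp, rfl⟩
    rw [this, mul_one]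
  · intro x z hx
    simp only [Set.mem_ofPred_eq] at hx ⊢
    rw [add_sub_right_comm]
    exact dvd_add hx (dvd_mul_right _ _)

end Linear

/-- Lift ρ to a root A modulo ℓ^(k+1). There the polynomial is (y - A)(y + u + A), and ℓ never
divides both factors, so the roots are A and -u - A. -/
lemma quadCount_eq_two {l : ℕ} (hl : l.Prime) {u w ρ : ℤ} (h0 : (l : ℤ) ∣ ρ ^ 2 + u * ρ + w)
    (h1 : ¬ (l : ℤ) ∣ 2 * ρ + u) (k : ℕ) : quadCount l u w (k + 1) (k + 1) = 2 := by
  obtain ⟨w', hw'⟩ := h0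
  obtain ⟨z, hz⟩ := exists_dvd_linear hl h1 (dvd_refl (l : ℤ)) w' k
  have hA : (l : ℤ) ^ (k + 1) ∣ (ρ + l * z) ^ 2 + u * (ρ + l * z) + w := by
    have := mul_dvd_mul_left (l : ℤ) hz
    rw [← pow_succ'] at this
    exact dvd_of_eq_right this (by linear_combination -hw')
  have hA' : ¬ (l : ℤ) ∣ 2 * (ρ + l * z) + u := fun h => h1 (by
    have := dvd_sub h (dvd_mul_right (l : ℤ) (2 * z))
    exact dvd_of_eq_right this (by ring))
  generalize ρ + l * z = A at hA hA'
  have hp := Nat.prime_iff_prime_int.1 hl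
  rw [quadCount, classCount]
  have : (Int.cast : ℤ → ZMod (l ^ (k + 1))) '' {y | (l : ℤ) ^ (k + 1) ∣ y ^ 2 + u * y + w} =
      {(A : ZMod (l ^ (k + 1))), ((-u - A : ℤ) : ZMod (l ^ (k + 1)))} := by
    ext c
    constructor
    · rintro ⟨y, hy, rfl⟩
      have h2 : (l : ℤ) ^ (k + 1) ∣ (y - A) * (y + u + A) := by
        have := dvd_sub hy hA
        exact dvd_of_eq_right this (by ring)
      by_cases h3 : (l : ℤ) ∣ y - A
      · left
        refine intCast_zmod_eq_iff.2 ?_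
        have h4 : IsCoprime ((l : ℤ) ^ (k + 1)) (y + u + A) := by
          refine IsCoprime.pow_left ((hp.coprime_iff_not_dvd).2 fun h => hA' ?_)
          have := dvd_sub h h3
          exact dvd_of_eq_right this (by ring)
        push_cast
        exact h4.dvd_of_dvd_mul_right h2
      · right
        refine intCast_zmod_eq_iff.2 ?_
        have h4 : IsCoprime ((l : ℤ) ^ (k + 1)) (y - A) :=
          IsCoprime.pow_left ((hp.coprime_iff_not_dvd).2 h3)
        push_cast
        have := h4.dvd_of_dvd_mul_left h2
        exact dvd_of_eq_right this (by ring)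
    · rintro (rfl | rfl)
      · exact ⟨A, hA, rfl⟩
      · refine ⟨-u - A, ?_, rfl⟩
        simp only [Set.mem_ofPred_eq]
        exact dvd_of_eq_right hA (by ring)
  rw [this, Set.ncard_pair]
  intro h
  rw [intCast_zmod_eq_iff] at h
  push_cast at h
  refine hA' ((dvd_pow_self (l : ℤ) (by omega : k + 1 ≠ 0)).trans ?_)
  exact dvd_of_eq_right h (by ring)

/-- A nonzero value makes the discriminant ℓ² times a discriminant, hence that of a polynomial with
both coefficients divisible by ℓ, which has one root modulo ℓ. -/
lemma hurwitzPow_eq_zero_of_nroots_ne_one {l : ℕ} (hl : l.Prime) {u w : ℤ} (hD : u ^ 2 - 4 * w < 0)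
    (hn : nroots l u w ≠ 1) (i : ℕ) : hurwitzPow l (u ^ 2 - 4 * w) (i + 1) = 0 := by
  by_contra hne
  obtain ⟨p, r, h⟩ := exists_disc_of_hurwitzPow_ne_zero hD.ne hl hne
  apply hn
  rw [nroots_congr l (p' := l * (l ^ i * p)) (r' := l * (l ^ (2 * i + 1) * r)) (by rw [h]; ring)]
  exact nroots_eq_one_of_dvd hl (dvd_mul_right _ _) (dvd_mul_right _ _)

/-- The polynomial is Eisenstein at ℓ, so its order is maximal there and its discriminant divided by
ℓ² is not a discriminant. -/
lemma hurwitzPow_eq_zero_of_not_sq_dvd {l : ℕ} (hl : l.Prime) {u w : ℤ} (hD : u ^ 2 - 4 * w < 0)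
    (hu : (l : ℤ) ∣ u) (hw : (l : ℤ) ∣ w) (hw2 : ¬ (l : ℤ) ^ 2 ∣ w) (i : ℕ) :
    hurwitzPow l (u ^ 2 - 4 * w) (i + 1) = 0 := by
  by_contra hne
  have hl0 : (l : ℤ) ≠ 0 := by exact_mod_cast hl.ne_zero
  obtain ⟨p, r, h⟩ := exists_disc_of_hurwitzPow_ne_zero hD.ne hl hne
  obtain ⟨u', rfl⟩ := hu
  obtain ⟨w', rfl⟩ := hw
  have h1 : (l : ℤ) * u' ^ 2 - 4 * w' = l * ((l ^ i * p) ^ 2 - 4 * (l ^ (2 * i) * r)) := by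
    have : (l : ℤ) * (l * u' ^ 2 - 4 * w') =
        l * (l * ((l ^ i * p) ^ 2 - 4 * (l ^ (2 * i) * r))) := by linear_combination h
    exact mul_left_cancel₀ hl0 this
  have hw' : ¬ (l : ℤ) ∣ w' := fun hd => hw2 (by rw [pow_two]; exact mul_dvd_mul_left _ hd)
  have h4 : (l : ℤ) ∣ 4 * w' :=
    ⟨u' ^ 2 - ((l ^ i * p) ^ 2 - 4 * (l ^ (2 * i) * r)), by linear_combination -h1⟩
  have hp := Nat.prime_iff_prime_int.1 hl
  rcases hp.dvd_or_dvd h4 with h5 | h5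
  · have hl2 : l = 2 := by
      have : l ∣ 2 ^ 2 := by exact_mod_cast h5
      exact (Nat.prime_dvd_prime_iff_eq hl Nat.prime_two).1 (hl.dvd_of_dvd_pow this)
    subst hl2
    generalize ((2 : ℕ) : ℤ) ^ i * p = P at h1
    generalize ((2 : ℕ) : ℤ) ^ (2 * i) * r = R at h1
    push_cast at h1 hw'
    -- For ℓ = 2, `h1` forces u' and P to have the same parity and then w' to be even.
    rcases Int.even_or_odd' u' with ⟨a, rfl | rfl⟩ <;> rcases Int.even_or_odd' P with ⟨b, rfl | rfl⟩ <;>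
      ring_nf at h1 <;> omega
  · exact hw' h5

end EllipticTerm

/-! ### The local identity for an arbitrary quadratic polynomial. -/

namespace EllipticTerm

open Finset in
/-- The local identity between the root counts of `y² + u y + w` modulo powers of `ℓ` and the
Hurwitz class numbers of discriminants `(u² - 4 w) / ℓ^(2 i)`. -/
def LocalIdentity (l : ℕ) (u w : ℤ) (m : ℕ) : Prop :=
  (l + 1 - nroots l u w : ℚ) * (hurwitzPow l (u ^ 2 - 4 * w) 0 - hurwitzPow l (u ^ 2 - 4 * w) 1) *
      (l ^ m + ∑ i ∈ range m, (l : ℚ) ^ i * quadCount l u w (m - i) (m - i)) +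
    ∑ i ∈ range (m + 1), (hurwitzPow l (u ^ 2 - 4 * w) i - hurwitzPow l (u ^ 2 - 4 * w) (i + 1)) *
      l ^ i * quadCount l u w (m + 1) (m + 1 + i) +
    l ^ m * (l + 1) * quadCount l u w (m + 1) (2 * m + 2) *
      hurwitzPow l (u ^ 2 - 4 * w) (m + 1) =
  l ^ m * (l + 1) * hurwitzPow l (u ^ 2 - 4 * w) 0

open Finset

/-- Inert case: the counts at positive exponents and all T_(i+1) vanish. -/
lemma localIdentity_of_no_root {l : ℕ} (hl : l.Prime) {u w : ℤ} (hD : u ^ 2 - 4 * w < 0)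
    (h : ∀ y : ℤ, ¬ (l : ℤ) ∣ y ^ 2 + u * y + w) (m : ℕ) : LocalIdentity l u w m := by
  have hq : ∀ k s, quadCount l u w k (s + 1) = 0 := fun k s =>
    quadCount_eq_zero (fun y hy => h y ((dvd_pow_self _ (by omega)).trans hy)) k
  have hn : nroots l u w = 0 := by rw [nroots_eq_quadCount, hq 1 0]
  have hT := hurwitzPow_eq_zero_of_nroots_ne_one hl hD (by omega)
  rw [LocalIdentity, hn, hT m, show (1 : ℕ) = 0 + 1 from rfl, hT 0, sum_eq_zero, sum_eq_zero]
  · push_cast; ring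
  · intro i _
    rw [show m + (0 + 1) + i = (m + i) + 1 by ring, hq]; simp
  · intro i hi
    have := mem_range.1 hi
    obtain ⟨s, hs⟩ : ∃ s, m - i = s + 1 := ⟨m - i - 1, by omega⟩
    rw [hs, hq]; simp

/-- Split case: the counts are 2 and only T_0 survives, so a geometric sum remains. -/
lemma localIdentity_of_simple_root {l : ℕ} (hl : l.Prime) {u w ρ : ℤ} (hD : u ^ 2 - 4 * w < 0)
    (h0 : (l : ℤ) ∣ ρ ^ 2 + u * ρ + w) (h1 : ¬ (l : ℤ) ∣ 2 * ρ + u) (m : ℕ) :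
    LocalIdentity l u w m := by
  have hq := quadCount_eq_two hl h0 h1
  have hn : nroots l u w = 2 := by rw [nroots_eq_quadCount, hq 0]
  have hT := hurwitzPow_eq_zero_of_nroots_ne_one hl hD (by omega)
  have hs1 : ∑ i ∈ range m, (l : ℚ) ^ i * quadCount l u w (m - i) (m - i) =
      (∑ i ∈ range m, (l : ℚ) ^ i) * 2 := by
    rw [sum_mul]
    refine sum_congr rfl fun i hi => ?_
    have := mem_range.1 hi
    obtain ⟨s, hs⟩ : ∃ s, m - i = s + 1 := ⟨m - i - 1, by omega⟩
    rw [hs, hq]; simp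
  have hs2 : ∀ i ∈ range m, (hurwitzPow l (u ^ 2 - 4 * w) (i + 1) -
      hurwitzPow l (u ^ 2 - 4 * w) (i + 1 + 1)) * (l : ℚ) ^ (i + 1) *
        quadCount l u w (m + 1) (m + 1 + (i + 1)) = 0 := fun i _ => by
    rw [hT, hT]; simp
  rw [LocalIdentity, hs1, sum_range_succ', sum_eq_zero hs2, hn, hT m]
  rw [add_zero, hq, zero_add, hT 0]
  have hg := geom_sum_mul (l : ℚ) m
  push_cast
  linear_combination 2 * hurwitzPow l (u ^ 2 - 4 * w) 0 * hg

/-- Eisenstein case: one root modulo ℓ, none modulo ℓ², and only T_0 survives. -/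
lemma localIdentity_of_not_sq_dvd {l : ℕ} (hl : l.Prime) {u w : ℤ} (hD : u ^ 2 - 4 * w < 0)
    (hu : (l : ℤ) ∣ u) (hw : (l : ℤ) ∣ w) (hw2 : ¬ (l : ℤ) ^ 2 ∣ w) (m : ℕ) :
    LocalIdentity l u w m := by
  have hT := hurwitzPow_eq_zero_of_not_sq_dvd hl hD hu hw hw2
  have hq1 := quadCount_one_one hl hu hw
  have hq : ∀ k s, quadCount l u w k (s + 2) = 0 := fun k s =>
    quadCount_eq_zero (fun y hy => by
      have hy2 : (l : ℤ) ^ 2 ∣ y ^ 2 + u * y + w := (pow_dvd_pow _ (by omega)).trans hy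
      have hly := dvd_of_dvd_quad hl hu hw ((dvd_pow_self _ two_ne_zero).trans hy2)
      refine hw2 ?_
      have h1 : (l : ℤ) ^ 2 ∣ y ^ 2 + u * y :=
        dvd_add (pow_dvd_pow_of_dvd hly 2) (by rw [pow_two]; exact mul_dvd_mul hu hly)
      exact (dvd_add_right h1).1 hy2) k
  have hs2 : ∀ i ∈ range m, (hurwitzPow l (u ^ 2 - 4 * w) (i + 1) -
      hurwitzPow l (u ^ 2 - 4 * w) (i + 1 + 1)) * (l : ℚ) ^ (i + 1) *
        quadCount l u w (m + 1) (m + 1 + (i + 1)) = 0 := fun i _ => by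
    rw [hT, hT]; simp
  rw [LocalIdentity, sum_range_succ', sum_eq_zero hs2, nroots_eq_one_of_dvd hl hu hw, hT m]
  rw [zero_add, hT 0]
  cases m with
  | zero => simp [hq1]; ring
  | succ m =>
    rw [sum_range_succ, sum_eq_zero fun i hi => ?_]
    · rw [show m + 1 - m = 1 by omega, hq1, show m + 1 + 1 + 0 = m + 2 by ring, hq]
      push_cast; ring
    · have := mem_range.1 hi
      obtain ⟨s, hs⟩ : ∃ s, m + 1 - i = s + 2 := ⟨m + 1 - i - 2, by omega⟩
      rw [hs, hq]; simp

/-- With D = u² - 4w, the identity at m + 1 is ℓ times the one at m plus ℓ(H(ℓ²D) - H(D)) times the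
relation `hX` between root sums. -/
lemma localIdentity_scale {l : ℕ} (hl : l.Prime) {u w : ℤ} (hD : u ^ 2 - 4 * w < 0) (m : ℕ)
    (ih : LocalIdentity l u w m) : LocalIdentity l (l * u) (l ^ 2 * w) (m + 1) := by
  have hu : (l : ℤ) ∣ l * u := dvd_mul_right _ _
  have hw : (l : ℤ) ∣ l ^ 2 * w := (dvd_pow_self _ two_ne_zero).mul_right _
  have hdisc : ((l : ℤ) * u) ^ 2 - 4 * (l ^ 2 * w) = l ^ 2 * (u ^ 2 - 4 * w) := by ring
  have hrel := hurwitzPow_sq_mul hl hD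
  have hq2 : ∀ k, quadCount l (l * u) (l ^ 2 * w) (k + 2) (k + 2) = l * quadCount l u w k k :=
    fun k => by rw [quadCount_scale hl, quadCount_succ hl]
  have hq1 := quadCount_one_one hl hu hw
  rw [LocalIdentity] at ih ⊢
  rw [hdisc, nroots_eq_one_of_dvd hl hu hw]
  simp only [hurwitzPow_succ hl]
  rw [show (1 : ℕ) = 0 + 1 from rfl] at hrel
  rw [hurwitzPow_succ hl] at hrel
  -- Rescaling lowers the exponent by two, which shifts the index by one. One ℓ^m is the term i = m
  -- on the left, the other comes from the count at exponent 0.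
  have hX : ∑ i ∈ range (m + 1), (l : ℚ) ^ i * quadCount l (l * u) (l ^ 2 * w) (m + 1 - i) (m + 1 - i)
      + quadCount l u w m m =
      ∑ i ∈ range m, (l : ℚ) ^ i * quadCount l u w (m - i) (m - i) + 2 * l ^ m := by
    have h1 := sum_range_succ (fun i => (l : ℚ) ^ i * quadCount l u w (m - i) (m - i)) m
    rw [sum_range_succ'] at h1
    rw [sum_range_succ, show m + 1 - m = 1 by omega, hq1]
    have h2 : ∑ i ∈ range m,
        (l : ℚ) ^ i * quadCount l (l * u) (l ^ 2 * w) (m + 1 - i) (m + 1 - i) =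
        ∑ i ∈ range m, (l : ℚ) ^ (i + 1) * quadCount l u w (m - (i + 1)) (m - (i + 1)) := by
      refine sum_congr rfl fun i hi => ?_
      have := mem_range.1 hi
      rw [show m + 1 - i = m - (i + 1) + 2 by omega, hq2]
      push_cast; ring
    rw [h2]
    simp only [Nat.sub_self, Nat.sub_zero, pow_zero, one_mul, quadCount_zero] at h1
    push_cast at h1 ⊢
    linear_combination h1
  have hZ : ∑ i ∈ range (m + 1 + 1), (hurwitzPow l ((l : ℤ) ^ 2 * (u ^ 2 - 4 * w)) i -
        hurwitzPow l (u ^ 2 - 4 * w) i) * (l : ℚ) ^ i *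
          quadCount l (l * u) (l ^ 2 * w) (m + 1 + 1) (m + 1 + 1 + i) =
      l * ∑ i ∈ range (m + 1), (hurwitzPow l (u ^ 2 - 4 * w) i -
        hurwitzPow l (u ^ 2 - 4 * w) (i + 1)) * l ^ i * quadCount l u w (m + 1) (m + 1 + i) +
      (hurwitzPow l ((l : ℤ) ^ 2 * (u ^ 2 - 4 * w)) 0 - hurwitzPow l (u ^ 2 - 4 * w) 0) *
        (l * quadCount l u w m m) := by
    rw [sum_range_succ', mul_sum]
    congr 1
    · refine sum_congr rfl fun i _ => ?_
      rw [hurwitzPow_succ hl, show m + 1 + 1 + (i + 1) = (m + 1 + i) + 2 by ring, quadCount_scale hl]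
      ring
    · rw [add_zero, hq2]; push_cast; ring
  rw [hZ, show 2 * (m + 1) + 2 = (2 * m + 2) + 2 by ring, quadCount_scale hl]
  rw [← hrel] at ih
  push_cast
  linear_combination (l : ℚ) * ih + l * (hurwitzPow l ((l : ℤ) ^ 2 * (u ^ 2 - 4 * w)) 0 -
    hurwitzPow l (u ^ 2 - 4 * w) 0) * hX

lemma localIdentity_zero_of_sq_dvd {l : ℕ} (hl : l.Prime) {u w : ℤ} :
    LocalIdentity l (l * u) (l ^ 2 * w) 0 := by
  have hu : (l : ℤ) ∣ l * u := dvd_mul_right _ _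
  have hw : (l : ℤ) ∣ l ^ 2 * w := (dvd_pow_self _ two_ne_zero).mul_right _
  have h2 : quadCount l (l * u) (l ^ 2 * w) 1 2 = 1 := by
    have := quadCount_scale hl u w 0 0
    rwa [quadCount_zero, pow_zero] at this
  rw [LocalIdentity, nroots_eq_one_of_dvd hl hu hw]
  simp only [range_zero, sum_empty, zero_add, sum_range_one, mul_zero, add_zero, pow_zero, h2,
    quadCount_one_one hl hu hw]
  push_cast
  ring

/-- A double root ρ modulo ℓ is translated to 0, so that ℓ divides both coefficients. Then the
polynomial is Eisenstein, or y = ℓz lowers m by one. -/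
theorem localIdentity {l : ℕ} (hl : l.Prime) {u w : ℤ} (hD : u ^ 2 - 4 * w < 0) (m : ℕ) :
    LocalIdentity l u w m := by
  have hl0 : (0 : ℤ) < l := by exact_mod_cast hl.pos
  induction m generalizing u w with
  | zero | succ m ih =>
    by_cases h : ∃ y : ℤ, (l : ℤ) ∣ y ^ 2 + u * y + w
    swap
    · exact localIdentity_of_no_root hl hD (not_exists.1 h) _
    obtain ⟨ρ, hρ⟩ := h
    by_cases h1 : (l : ℤ) ∣ 2 * ρ + u
    swap
    · exact localIdentity_of_simple_root hl hD hρ h1 _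
    have hdisc : (2 * ρ + u) ^ 2 - 4 * (ρ ^ 2 + u * ρ + w) = u ^ 2 - 4 * w := by ring
    suffices H : LocalIdentity l (2 * ρ + u) (ρ ^ 2 + u * ρ + w) _ by
      unfold LocalIdentity at H ⊢
      rw [hdisc, nroots_congr l hdisc] at H
      simpa only [quadCount_translate] using H
    rw [← hdisc] at hD
    by_cases h2 : (l : ℤ) ^ 2 ∣ ρ ^ 2 + u * ρ + w
    swap
    · exact localIdentity_of_not_sq_dvd hl hD h1 hρ h2 _
    generalize 2 * ρ + u = u at *
    generalize ρ ^ 2 + _ * ρ + w = w at *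
    obtain ⟨u, rfl⟩ := h1
    obtain ⟨w, rfl⟩ := h2
    first
    | exact localIdentity_zero_of_sq_dvd hl
    | refine localIdentity_scale hl ?_ m (ih ?_) <;>
      exact (by
        have e : ((l : ℤ) * u) ^ 2 - 4 * (l ^ 2 * w) = l ^ 2 * (u ^ 2 - 4 * w) := by ring
        rw [e] at hD
        exact (pos_iff_neg_of_mul_neg hD).1 (by positivity))

end EllipticTerm

/-! ### Expressing both sides through an integer lift b of d⁻¹. -/

namespace EllipticTerm

lemma psi_prime_pow_succ {l : ℕ} (hl : l.Prime) (k : ℕ) :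
    psi (l ^ (k + 1)) = (l : ℚ) ^ k * (l + 1) := by
  have : (l : ℚ) ≠ 0 := by exact_mod_cast hl.ne_zero
  rw [psi, Nat.primeFactors_pow _ (by omega), hl.primeFactors, Finset.prod_singleton]
  push_cast
  field_simp
  ring

lemma psi_one : psi 1 = 1 := by simp [psi]

lemma psi_div_psi {l : ℕ} (hl : l.Prime) {k n : ℕ} (h : k < n) :
    psi (l ^ n) / psi (l ^ (n - k)) = (l : ℚ) ^ k := by
  have hl0 : (l : ℚ) ≠ 0 := by exact_mod_cast hl.ne_zero
  have hl1 : (l : ℚ) + 1 ≠ 0 := by positivity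
  obtain ⟨j, rfl⟩ : ∃ j, n = k + j + 1 := ⟨n - k - 1, by omega⟩
  rw [show k + j + 1 - k = j + 1 by omega, psi_prime_pow_succ hl, psi_prime_pow_succ hl, pow_add]
  field_simp

section Lifts

variable {l γ : ℕ} {d : (ZMod (l ^ γ))ˣ}

/-- The modulus ℓ^(2γ) suffices for every D(t; ℓ^(γ+f)) with f ≤ γ. -/
lemma exists_lift_inverse (hl : l.Prime) (d : (ZMod (l ^ γ))ˣ) : ∃ a b : ℤ,
    (a : ZMod (l ^ γ)) = d ∧ (l : ℤ) ^ (2 * γ) ∣ a * b - 1 := by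
  have : NeZero (l ^ γ) := ⟨pow_ne_zero γ hl.ne_zero⟩
  rcases Nat.eq_zero_or_pos γ with rfl | hγ
  · exact ⟨1, 1, Subsingleton.elim (α := ZMod 1) _ _, by simp⟩
  · have h1 : Nat.Coprime (d : ZMod (l ^ γ)).val l :=
      (Nat.coprime_pow_right_iff hγ _ _).1 (ZMod.val_coe_unit_coprime d)
    have h2 : IsCoprime ((d : ZMod (l ^ γ)).val : ℤ) ((l : ℤ) ^ (2 * γ)) :=
      (Nat.isCoprime_iff_coprime.2 h1).pow_right
    obtain ⟨x, y, hxy⟩ := h2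
    exact ⟨(d : ZMod (l ^ γ)).val, x, by push_cast; exact ZMod.natCast_zmod_val _,
      -y, by linear_combination hxy⟩

lemma intCast_eq_inv {a b : ℤ} (ha : (a : ZMod (l ^ γ)) = d)
    (hab : (l : ℤ) ^ (2 * γ) ∣ a * b - 1) : (b : ZMod (l ^ γ)) = ((d⁻¹ : (ZMod (l ^ γ))ˣ) : ZMod (l ^ γ)) := by
  have h1 : (l : ℤ) ^ γ ∣ a * b - 1 := (pow_dvd_pow _ (by omega)).trans hab
  have h2 : ((a * b : ℤ) : ZMod (l ^ γ)) = (1 : ℤ) := intCast_zmod_eq_iff.2 (by push_cast; exact h1)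
  push_cast at h2
  rw [ha] at h2
  rw [← one_mul (b : ZMod (l ^ γ)), ← d.inv_mul, mul_assoc, h2, mul_one]

lemma pow_dvd_val_iff (hl : l.Prime) {x : ZMod (l ^ γ)} {z : ℤ} (h : (z : ZMod (l ^ γ)) = x) {i : ℕ}
    (hi : i ≤ γ) : l ^ i ∣ x.val ↔ (l : ℤ) ^ i ∣ z := by
  have : NeZero (l ^ γ) := ⟨pow_ne_zero γ hl.ne_zero⟩
  have h1 : ((l ^ γ : ℕ) : ℤ) ∣ z - x.val := intCast_zmod_eq_iff.1 (by
    rw [h]; push_cast; rw [ZMod.natCast_zmod_val])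
  have h2 : (l : ℤ) ^ i ∣ z - x.val := by
    push_cast at h1
    exact (pow_dvd_pow _ hi).trans h1
  rw [← Int.natCast_dvd_natCast]
  push_cast
  exact (dvd_iff_dvd_of_dvd_sub h2).symm

/-- `b` is an approximate inverse of `a` for which `b² - q` has valuation `β`, up to level `γ`. -/
structure IsLift (l β γ q : ℕ) (a b : ℤ) : Prop where
  le : β ≤ γ
  mul : (l : ℤ) ^ (2 * γ) ∣ a * b - 1
  dvd_iff : ∀ i ≤ γ, (l : ℤ) ^ i ∣ b ^ 2 - q ↔ i ≤ β
  dvd_iff' : ∀ i ≤ γ, (l : ℤ) ^ i ∣ a ^ 2 * q - 1 ↔ i ≤ β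

lemma isLift_of_gcd {β q : ℕ} (hl : l.Prime) (hβγ : β ≤ γ) {a b : ℤ}
    (hd : Nat.gcd ((d : ZMod (l ^ γ)) ^ 2 * (q : ZMod (l ^ γ)) - 1).val (l ^ γ) = l ^ β)
    (ha : (a : ZMod (l ^ γ)) = d) (hab : (l : ℤ) ^ (2 * γ) ∣ a * b - 1) : IsLift l β γ q a b := by
  have h1 : ∀ i ≤ γ, (l : ℤ) ^ i ∣ a ^ 2 * q - 1 ↔ i ≤ β := fun i hi => by
    rw [← pow_dvd_val_iff hl (x := (d : ZMod (l ^ γ)) ^ 2 * (q : ZMod (l ^ γ)) - 1)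
      (by push_cast; rw [ha]) hi, ← Nat.pow_dvd_pow_iff_le_right hl.one_lt, ← hd, Nat.dvd_gcd_iff,
      and_iff_left (pow_dvd_pow _ hi)]
  refine ⟨hβγ, hab, fun i hi => ?_, h1⟩
  rw [← h1 i hi]
  have h2 : (l : ℤ) ^ i ∣ a * b - 1 := (pow_dvd_pow _ (by omega)).trans hab
  constructor
  · intro h
    exact dvd_of_eq_right (dvd_add (h.mul_left (-a ^ 2)) (h2.mul_left (a * b + 1))) (by ring)
  · intro h
    exact dvd_of_eq_right (dvd_add (h.mul_left (-b ^ 2)) (h2.mul_left (q * (a * b + 1)))) (by ring)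

lemma deltaSq_eq {β q : ℕ} (hl : l.Prime) {a b : ℤ} (h : IsLift l β γ q a b)
    (ha : (a : ZMod (l ^ γ)) = d) {i : ℕ} (hi : i ≤ γ) :
    deltaSq l γ q d i = if i ≤ β then 1 else 0 := by
  rw [deltaSq]
  congr 1
  rw [pow_dvd_val_iff hl (z := a ^ 2 * q - 1) (by push_cast; rw [ha]) hi, h.dvd_iff' i hi]

open Classical in
-- As a b ≡ 1, multiplying a q + b - t by the unit b gives b² - t b + q.
lemma deltaTrace_eq {β q : ℕ} {a b : ℤ} (h : IsLift l β γ q a b)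
    (ha : (a : ZMod (l ^ γ)) = d) (t : ℤ) {f : ℕ} (hf : f ≤ β) :
    deltaTrace l γ q d t (γ + f) = if (l : ℤ) ^ (γ + f) ∣ b ^ 2 - t * b + q then 1 else 0 := by
  have hle := h.le
  have hab : (l : ℤ) ^ (γ + f) ∣ a * b - 1 := (pow_dvd_pow _ (by omega)).trans h.mul
  rw [deltaTrace]
  congr 1
  rw [eq_iff_iff]
  have key : (l : ℤ) ^ (γ + f) ∣ b ^ 2 - t * b + q ↔ (l : ℤ) ^ (γ + f) ∣ a * q + b - t := by
    constructor
    · intro h1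
      exact dvd_of_eq_right (dvd_sub (h1.mul_left a) (hab.mul_right (b - t))) (by ring)
    · intro h1
      exact dvd_of_eq_right (dvd_sub (h1.mul_left b) (hab.mul_left q)) (by ring)
  rw [key]
  constructor
  · rintro ⟨a', b', ha', hab', h1⟩
    have h2 : (l : ℤ) ^ γ ∣ a - a' := by
      have := intCast_zmod_eq_iff.1 (ha.trans ha'.symm)
      exact_mod_cast this
    have h3 := deltaTrace_wellDefined (B := f) (i := γ + f) (q := q) (hf.trans hle) (by omega) le_rfl
      h2 ((h.dvd_iff' f (hf.trans hle)).2 hf) hab hab'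
    exact dvd_of_eq_right (dvd_add h1 h3) (by ring)
  · intro h1
    exact ⟨a, b, ha, hab, h1⟩

open Classical in
-- A difference of consecutive D's is nonzero only where divisibility first fails, at f + k = e.
-- That term is present only if e ≤ β, where `deltaSq` is 1, and e < γ, the range of k.
lemma classH_eq {β q : ℕ} (hl : l.Prime) {a b : ℤ} (h : IsLift l β γ q a b)
    (ha : (a : ZMod (l ^ γ)) = d) (t : ℤ) {f e : ℕ} (hfβ : f ≤ β)
    (he : ∀ i ≤ β, (l : ℤ) ^ (γ + i) ∣ b ^ 2 - t * b + q ↔ i < e) :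
    2 * classH l γ f t q d = if f < e then hurwitzPow l (t ^ 2 - 4 * q) f -
      (if e ≤ β ∧ e < γ then hurwitzPow l (t ^ 2 - 4 * q) e else 0) else 0 := by
  have hle := h.le
  have hterm : ∀ k ∈ Finset.Icc 1 (γ - f - 1),
      1 / 2 * hurwitzDiv (t ^ 2 - 4 * q) (l ^ (f + k)) * deltaSq l γ q d (f + k) *
        (deltaTrace l γ q d t (γ + f + k - 1) - deltaTrace l γ q d t (γ + f + k)) =
      if f + k = e ∧ e ≤ β then 1 / 2 * hurwitzPow l (t ^ 2 - 4 * q) e else 0 := by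
    intro k hk
    rw [Finset.mem_Icc] at hk
    rw [deltaSq_eq hl h ha (by omega)]
    by_cases hkβ : f + k ≤ β
    · rw [if_pos hkβ, show γ + f + k - 1 = γ + (f + k - 1) by omega, add_assoc γ f k,
        deltaTrace_eq h ha t hkβ, deltaTrace_eq h ha t (by omega), if_congr (he _ hkβ) rfl rfl,
        if_congr (he _ (by omega)) rfl rfl, hurwitzPow]
      by_cases h1 : f + k = e
      · subst h1
        rw [if_pos (by omega), if_neg (by omega), if_pos ⟨rfl, hkβ⟩]; ring
      · rw [if_neg (show ¬ (f + k = e ∧ e ≤ β) from fun hh => h1 hh.1)]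
        by_cases h2 : f + k < e
        · rw [if_pos (by omega), if_pos h2]; ring
        · rw [if_neg (by omega), if_neg h2]; ring
    · rw [if_neg hkβ, if_neg (by omega)]; ring
  rw [classH, Finset.sum_congr rfl hterm, deltaSq_eq hl h ha (hfβ.trans hle), if_pos hfβ,
    deltaTrace_eq h ha t hfβ, if_congr (he _ hfβ) rfl rfl]
  by_cases hfe : f < e
  · rw [if_pos hfe, if_pos hfe]
    by_cases h1 : e ≤ β ∧ e < γ
    · rw [if_pos h1, Finset.sum_eq_single (e - f), if_pos ⟨by omega, h1.1⟩, hurwitzPow, hurwitzPow]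
      · ring
      · intro k hk hne
        rw [if_neg (by omega)]
      · intro hk
        exact absurd (Finset.mem_Icc.2 ⟨by omega, by omega⟩) hk
    · rw [if_neg h1, Finset.sum_eq_zero, hurwitzPow]
      · ring
      · intro k hk
        rw [Finset.mem_Icc] at hk
        rw [if_neg (by omega)]
  · rw [if_neg hfe, if_neg hfe, Finset.sum_eq_zero]
    · ring
    · intro k hk
      rw [Finset.mem_Icc] at hk
      rw [if_neg (by omega)]

/-- Write c = b + ℓ^γ y; since ℓ ∤ q, a root is automatically a unit. -/
lemma rootCount_eq {q α : ℕ} (hl : l.Prime) (hq : ¬ l ∣ q) {b : ℤ}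
    (hb : (b : ZMod (l ^ γ)) = ((d⁻¹ : (ZMod (l ^ γ))ˣ) : ZMod (l ^ γ))) (t : ℤ) {m : ℕ} (hm : m ≠ 0) :
    rootCount l α γ t q d m = classCount (l ^ α) {y | (l : ℤ) ^ (α + γ +
      min (padicValNat l m) (α + γ)) ∣ (b + l ^ γ * y) ^ 2 - t * (b + l ^ γ * y) + q} := by
  have : Fact l.Prime := ⟨hl⟩
  have hl0 : (l : ℤ) ≠ 0 := by exact_mod_cast hl.ne_zero
  have hgcd : Nat.gcd (l ^ (α + γ)) m = l ^ min (padicValNat l m) (α + γ) := by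
    obtain ⟨k, hk, hk'⟩ := (Nat.dvd_prime_pow hl).1 (Nat.gcd_dvd_left (l ^ (α + γ)) m)
    rw [hk']
    congr 1
    apply le_antisymm
    · refine le_min ?_ hk
      rw [← padicValNat_dvd_iff_le hm, ← hk']
      exact Nat.gcd_dvd_right _ _
    · rw [← Nat.pow_dvd_pow_iff_le_right hl.one_lt, ← hk']
      exact Nat.dvd_gcd (pow_dvd_pow _ (min_le_right _ _))
        ((padicValNat_dvd_iff_le hm).2 (min_le_left _ _))
  rw [rootCount, ← Set.ncard_image_of_injective _ Units.val_injective,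
    ← classCount_image (M := l ^ α) (M' := l ^ (α + γ)) _ (fun y => b + l ^ γ * y) (fun x y => by
      push_cast
      rw [add_sub_add_left_eq_sub, ← mul_sub, add_comm α, pow_add,
        mul_dvd_mul_iff_left (pow_ne_zero γ hl0)]), classCount]
  congr 1
  ext c
  constructor
  · rintro ⟨c, ⟨⟨x, hxc, hx⟩, hc⟩, rfl⟩
    have h1 : (x : ZMod (l ^ γ)) = b := by
      rw [hb, ← hc, ZMod.unitsMap_val, ← hxc, ZMod.cast_intCast (pow_dvd_pow l (Nat.le_add_left γ α))]
    obtain ⟨y, hy⟩ := intCast_zmod_eq_iff.1 h1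
    refine ⟨x, ⟨y, ?_, ?_⟩, hxc⟩
    · rw [hgcd, ← pow_add] at hx
      push_cast at hx hy
      rw [Set.mem_ofPred_eq, show b + (l : ℤ) ^ γ * y = x by linarith]
      exact hx
    · push_cast at hy
      dsimp only
      linarith
  · rintro ⟨_, ⟨y, hy, rfl⟩, rfl⟩
    rw [Set.mem_ofPred_eq] at hy
    set x := b + (l : ℤ) ^ γ * y with hx
    have hcop : IsCoprime x ((l : ℤ) ^ (α + γ)) := by
      rcases Nat.eq_zero_or_pos (α + γ) with h0 | h0
      · rw [h0, pow_zero]; exact isCoprime_one_right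
      · refine IsCoprime.pow_right (IsCoprime.symm ?_)
        rw [(Nat.prime_iff_prime_int.1 hl).coprime_iff_not_dvd]
        intro hlx
        have h1 : (l : ℤ) ∣ x ^ 2 - t * x + q := (dvd_pow_self _ (by omega)).trans hy
        have h2 : (l : ℤ) ∣ x ^ 2 - t * x :=
          dvd_sub (hlx.trans (dvd_pow_self _ two_ne_zero)) (hlx.mul_left t)
        exact hq (by exact_mod_cast (dvd_add_right h2).1 h1)
    obtain ⟨u, v, huv⟩ := hcop
    have hunit : (x : ZMod (l ^ (α + γ))) * u = 1 := by
      have h1 : ((x * u : ℤ) : ZMod (l ^ (α + γ))) = (1 : ℤ) := intCast_zmod_eq_iff.2 (by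
        push_cast; exact ⟨-v, by linear_combination huv⟩)
      push_cast at h1
      exact h1
    refine ⟨Units.mkOfMulEqOne _ _ hunit, ⟨⟨x, rfl, ?_⟩, ?_⟩, rfl⟩
    · rw [hgcd, ← pow_add]; push_cast; exact hy
    · ext1
      rw [ZMod.unitsMap_val, Units.val_mkOfMulEqOne,
        ZMod.cast_intCast (pow_dvd_pow l (Nat.le_add_left γ α)), ← hb, intCast_zmod_eq_iff]
      push_cast
      exact ⟨y, by rw [hx]; ring⟩

/-- The number of classes `y` modulo `ℓ^α` for which `b + ℓ^γ y` lifts to a root modulo `ℓ^s`. -/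
noncomputable def shiftCount (l α γ : ℕ) (t : ℤ) (q : ℕ) (b : ℤ) (s : ℕ) : ℕ :=
  classCount (l ^ α) {y | (l : ℤ) ^ s ∣ (b + l ^ γ * y) ^ 2 - t * (b + l ^ γ * y) + q}

/-- The quotient of ψ-values is ℓ^κ for κ < α + γ. At κ = α + γ the denominator is ψ(1) = 1, so this
term stands apart. -/
lemma ellipticC_eq {q α : ℕ} (hl : l.Prime) (hq : ¬ l ∣ q) {b : ℤ}
    (hb : (b : ZMod (l ^ γ)) = ((d⁻¹ : (ZMod (l ^ γ))ˣ) : ZMod (l ^ γ))) (t : ℤ)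
    (ht : t ^ 2 - 4 * (q : ℤ) ≠ 0) :
    ellipticC l α γ t q d = ∑ κ ∈ Finset.range (α + γ),
      (l : ℚ) ^ κ * shiftCount l α γ t q b (α + γ + κ) *
        (hurwitzPow l (t ^ 2 - 4 * q) κ - hurwitzPow l (t ^ 2 - 4 * q) (κ + 1)) +
      psi (l ^ (α + γ)) * shiftCount l α γ t q b (α + γ + (α + γ)) *
        hurwitzPow l (t ^ 2 - 4 * q) (α + γ) := by
  have h1 := sum_sqDivisors_mul hl ht (fun κ => psi (l ^ (α + γ)) / psi (l ^ (α + γ - κ)) *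
    shiftCount l α γ t q b (α + γ + κ)) (α + γ)
  rw [Nat.sub_self, pow_zero, psi_one, div_one] at h1
  have h2 : ellipticC l α γ t q d = ∑ m ∈ sqDivisors (t ^ 2 - 4 * q),
      hw ((t ^ 2 - 4 * q) / (m : ℤ) ^ 2) * (psi (l ^ (α + γ)) /
        psi (l ^ (α + γ - min (padicValNat l m) (α + γ))) *
          shiftCount l α γ t q b (α + γ + min (padicValNat l m) (α + γ))) := by
    rw [ellipticC]
    refine Finset.sum_congr rfl fun m hm => ?_
    rw [rootCount_eq hl hq hb t ((mem_sqDivisors ht).1 hm).1.ne', shiftCount, mul_assoc]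
  rw [h2, h1]
  congr 1
  refine Finset.sum_congr rfl fun κ hκ => ?_
  rw [psi_div_psi hl (Finset.mem_range.1 hκ)]

end Lifts

end EllipticTerm

/-! ### Summation of the weights, and the cases by valuation of b² - t b + q. -/

namespace EllipticTerm

open Finset

/-- The coefficients `φ(ℓ^(2 j)) φ(ℓ^(n - j)) / φ(ℓ^n)`. -/
noncomputable def weight (l n j : ℕ) : ℚ :=
  (Nat.totient (l ^ (2 * j)) : ℚ) * (Nat.totient (l ^ (n - j)) : ℚ) / (Nat.totient (l ^ n) : ℚ)

section Weight

variable {l : ℕ}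

lemma totient_pow_succ (hl : l.Prime) (k : ℕ) :
    (Nat.totient (l ^ (k + 1)) : ℚ) = (l : ℚ) ^ k * (l - 1) := by
  rw [Nat.totient_prime_pow_succ hl]
  push_cast [hl.one_le]
  ring

lemma cast_sub_one_ne_zero (hl : l.Prime) : (l : ℚ) - 1 ≠ 0 := by
  rw [sub_ne_zero]; exact_mod_cast hl.one_lt.ne'

lemma weight_zero (hl : l.Prime) (n : ℕ) : weight l n 0 = 1 := by
  have : (Nat.totient (l ^ n) : ℚ) ≠ 0 := by
    exact_mod_cast (Nat.totient_pos.2 (pow_pos hl.pos n)).ne'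
  rw [weight]
  simp [this]

lemma weight_succ (hl : l.Prime) {n j : ℕ} (h : j + 1 < n) :
    weight l n (j + 1) = (l : ℚ) ^ j * (l - 1) := by
  have hl0 : (l : ℚ) ≠ 0 := by exact_mod_cast hl.ne_zero
  have hl1 := cast_sub_one_ne_zero hl
  obtain ⟨r, rfl⟩ : ∃ r, n = j + r + 1 + 1 := ⟨n - j - 2, by omega⟩
  rw [weight, show 2 * (j + 1) = (2 * j + 1) + 1 by ring,
    show j + r + 1 + 1 - (j + 1) = r + 1 by omega, totient_pow_succ hl, totient_pow_succ hl,
    totient_pow_succ hl]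
  field_simp
  ring

lemma weight_self (hl : l.Prime) (n : ℕ) : weight l (n + 1) (n + 1) = (l : ℚ) ^ (n + 1) := by
  have hl0 : (l : ℚ) ≠ 0 := by exact_mod_cast hl.ne_zero
  have hl1 := cast_sub_one_ne_zero hl
  rw [weight, show 2 * (n + 1) = (2 * n + 1) + 1 by ring, Nat.sub_self, pow_zero, Nat.totient_one,
    totient_pow_succ hl, totient_pow_succ hl]
  field_simp
  ring

/-- Summation by parts: the weights are 1 at j = 0 and ℓ^j - ℓ^(j-1) for 0 < j < n. -/
lemma sum_weight (hl : l.Prime) {n J : ℕ} (h : J = 0 ∨ J < n) (τ : ℕ → ℚ) :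
    ∑ j ∈ range (J + 1), weight l n j * τ j =
      ∑ i ∈ range J, (l : ℚ) ^ i * (τ i - τ (i + 1)) + l ^ J * τ J := by
  induction J with
  | zero => simp [weight_zero hl]
  | succ J ih =>
    rw [sum_range_succ, ih (by omega), sum_range_succ, weight_succ hl (by omega)]
    ring

/-- Because φ(1) = 1, the last weight exceeds the pattern of `sum_weight` by ℓ^n. -/
lemma sum_weight_top (hl : l.Prime) (n : ℕ) (τ : ℕ → ℚ) :
    ∑ j ∈ range (n + 1 + 1), weight l (n + 1) j * τ j =
      ∑ i ∈ range (n + 1), (l : ℚ) ^ i * (τ i - τ (i + 1)) + (l ^ (n + 1) + l ^ n) * τ (n + 1) := by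
  rw [sum_range_succ, sum_weight hl (by omega), sum_range_succ, weight_self hl]
  ring

end Weight

variable {l α β γ q : ℕ} {a b t : ℤ}

lemma shift_expand (l γ q : ℕ) (b t y : ℤ) :
    (b + (l : ℤ) ^ γ * y) ^ 2 - t * (b + l ^ γ * y) + q =
      (b ^ 2 - t * b + q) + l ^ γ * (2 * b - t) * y + l ^ (2 * γ) * y ^ 2 := by ring

/-- b(2b - t) = (b² - t b + q) + (b² - q), and b is a unit modulo ℓ^β. -/
lemma IsLift.dvd_deriv (h : IsLift l β γ q a b) (hF : (l : ℤ) ^ γ ∣ b ^ 2 - t * b + q) :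
    (l : ℤ) ^ β ∣ 2 * b - t := by
  have hle := h.le
  have h1 : (l : ℤ) ^ β ∣ b ^ 2 - t * b + q := (pow_dvd_pow _ hle).trans hF
  have h2 : (l : ℤ) ^ β ∣ b ^ 2 - q := (h.dvd_iff β hle).2 le_rfl
  have h3 : (l : ℤ) ^ β ∣ a * b - 1 := (pow_dvd_pow _ (by omega)).trans h.mul
  exact dvd_of_eq_right (dvd_sub ((dvd_add h1 h2).mul_left a) (h3.mul_right (2 * b - t))) (by ring)

/-- A root forces ℓ^γ ∣ F(b), hence ℓ^β ∣ F'(b); then F(b + ℓ^γ y) ≡ F(b) modulo ℓ^(γ+α). -/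
lemma shiftCount_eq_zero (h : IsLift l β γ q a b) (hαβ : α ≤ β)
    (hF : ¬ (l : ℤ) ^ (γ + α) ∣ b ^ 2 - t * b + q) (κ : ℕ) :
    shiftCount l α γ t q b (α + γ + κ) = 0 := by
  have hle := h.le
  rw [shiftCount, ← classCount_empty]
  congr 1
  refine Set.eq_empty_of_forall_notMem fun y hy => hF ?_
  rw [Set.mem_ofPred_eq, shift_expand] at hy
  have h1 : (l : ℤ) ^ (γ + α) ∣ (b ^ 2 - t * b + q) + l ^ γ * (2 * b - t) * y + l ^ (2 * γ) * y ^ 2 :=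
    (pow_dvd_pow _ (by omega)).trans hy
  have h2 : (l : ℤ) ^ (γ + α) ∣ l ^ (2 * γ) * y ^ 2 := (pow_dvd_pow _ (by omega)).mul_right _
  have h3 := (dvd_add_left h2).1 h1
  have h4 : (l : ℤ) ^ γ ∣ b ^ 2 - t * b + q :=
    (dvd_add_left (((dvd_refl _).mul_right _).mul_right y)).1 ((pow_dvd_pow _ (by omega)).trans h3)
  have h5 : (l : ℤ) ^ (γ + α) ∣ l ^ γ * (2 * b - t) * y := by
    rw [pow_add]
    exact (mul_dvd_mul_left _ ((pow_dvd_pow _ hαβ).trans (h.dvd_deriv h4))).mul_right y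
  exact (dvd_add_left h5).1 h3

/-- The value of `C(t,q,d)` in terms of root counts near `b ≡ d⁻¹`. -/
noncomputable def rootSum (l α γ : ℕ) (t : ℤ) (q : ℕ) (b : ℤ) : ℚ :=
  ∑ κ ∈ range (α + γ), (l : ℚ) ^ κ * shiftCount l α γ t q b (α + γ + κ) *
      (hurwitzPow l (t ^ 2 - 4 * q) κ - hurwitzPow l (t ^ 2 - 4 * q) (κ + 1)) +
    psi (l ^ (α + γ)) * shiftCount l α γ t q b (α + γ + (α + γ)) *
      hurwitzPow l (t ^ 2 - 4 * q) (α + γ)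

lemma rootSum_eq_zero (h : IsLift l β γ q a b) (hαβ : α ≤ β)
    (hF : ¬ (l : ℤ) ^ (γ + α) ∣ b ^ 2 - t * b + q) : rootSum l α γ t q b = 0 := by
  simp [rootSum, shiftCount_eq_zero h hαβ hF]

lemma psi_ratio (hl : l.Prime) (h : α < γ) :
    psi (l ^ (2 * γ)) / psi (l ^ (2 * γ - 2 * α)) = (l : ℚ) ^ (2 * α) :=
  psi_div_psi hl (by omega)

section BelowLevel

/-! The case in which `b² - t b + q` has valuation `γ + e` with `e < β`. -/

variable {e : ℕ} {G V : ℤ}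

/-- The terms in y are divisible by ℓ^(γ+β), so every F(b + ℓ^γ y) has valuation exactly γ + e. -/
lemma shiftCount_of_lt (hl : l.Prime) (heβ : e < β) (hβγ : β ≤ γ)
    (hF : b ^ 2 - t * b + q = (l : ℤ) ^ (γ + e) * G) (hG : ¬ (l : ℤ) ∣ G)
    (hV : 2 * b - t = (l : ℤ) ^ β * V) (κ : ℕ) :
    shiftCount l α γ t q b (α + γ + κ) = if α + κ ≤ e then l ^ α else 0 := by
  have hl0 : (l : ℤ) ≠ 0 := by exact_mod_cast hl.ne_zero
  obtain ⟨x, rfl⟩ : ∃ x, β = e + 1 + x := ⟨β - e - 1, by omega⟩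
  obtain ⟨z, rfl⟩ : ∃ z, γ = e + 1 + x + z := ⟨_, (Nat.add_sub_of_le hβγ).symm⟩
  have hexp : ∀ y : ℤ, (b ^ 2 - t * b + q) + (l : ℤ) ^ (e + 1 + x + z) * (2 * b - t) * y +
      l ^ (2 * (e + 1 + x + z)) * y ^ 2 = l ^ (e + 1 + x + z + e) *
        (G + l * (l ^ x * V * y + l ^ (x + z) * y ^ 2)) := fun y => by
    rw [hF, hV]; ring
  rw [shiftCount]
  simp only [shift_expand, hexp]
  split_ifs with hκ
  · refine Eq.trans ?_ (classCount_univ (M := l ^ α))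
    congr 1
    refine Set.eq_univ_of_forall fun y => ?_
    exact (pow_dvd_pow _ (by omega)).mul_right _
  · rw [← classCount_empty]
    congr 1
    refine Set.eq_empty_of_forall_notMem fun y hy => hG ?_
    rw [Set.mem_ofPred_eq] at hy
    have h1 : (l : ℤ) ^ (e + 1 + x + z + e) * l ∣ l ^ (e + 1 + x + z + e) *
        (G + l * (l ^ x * V * y + l ^ (x + z) * y ^ 2)) := by
      rw [← pow_succ]; exact (pow_dvd_pow _ (by omega)).trans hy
    exact (dvd_add_left (dvd_mul_right _ _)).1
      ((mul_dvd_mul_iff_left (pow_ne_zero _ hl0)).1 h1)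

/-- Here T_κ - T_(κ+1) = ℓ^(e-κ) (T_e - T_(e+1)) for κ ≤ e, and each side becomes e - α + 1 equal
terms. -/
lemma rootSum_of_lt (hl : l.Prime) (hαe : α ≤ e) (heβ : e < β) (hβγ : β ≤ γ)
    (hΔ : t ^ 2 - 4 * (q : ℤ) < 0)
    (hF : b ^ 2 - t * b + q = (l : ℤ) ^ (γ + e) * G) (hG : ¬ (l : ℤ) ∣ G)
    (hV : 2 * b - t = (l : ℤ) ^ β * V) (C : ℕ → ℚ)
    (hC : ∀ j ≤ β - α, C j = if α + j < e + 1 then hurwitzPow l (t ^ 2 - 4 * q) (α + j) -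
      (if e + 1 ≤ β ∧ e + 1 < γ then hurwitzPow l (t ^ 2 - 4 * q) (e + 1) else 0) else 0) :
    rootSum l α γ t q b = psi (l ^ (2 * γ)) / psi (l ^ (2 * γ - 2 * α)) *
      ∑ j ∈ range (β - α + 1), weight l (γ - α) j * C j := by
  have hl0 : (0 : ℤ) < l := by exact_mod_cast hl.pos
  have hW := shiftCount_of_lt (α := α) hl heβ hβγ hF hG hV
  obtain ⟨x, hx⟩ : ∃ x, β = e + 1 + x := ⟨β - e - 1, by omega⟩
  obtain ⟨z, hz⟩ : ∃ z, γ = e + 1 + z := ⟨γ - e - 1, by omega⟩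
  obtain ⟨J, rfl⟩ : ∃ J, e = α + J := ⟨e - α, by omega⟩
  have hdisc : t ^ 2 - 4 * (q : ℤ) =
      l ^ (2 * (α + J)) * ((l * (l ^ x * V)) ^ 2 - 4 * (l * (l ^ z * G))) := by
    have : t ^ 2 - 4 * (q : ℤ) = (2 * b - t) ^ 2 - 4 * (b ^ 2 - t * b + q) := by ring
    rw [this, hF, hV, hx, hz]; ring
  have hneg : ((l : ℤ) * (l ^ x * V)) ^ 2 - 4 * (l * (l ^ z * G)) < 0 := by
    rw [hdisc] at hΔ
    exact (pos_iff_neg_of_mul_neg hΔ).1 (by positivity)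
  have hn := nroots_eq_one_of_dvd hl (dvd_mul_right (l : ℤ) (l ^ x * V)) (dvd_mul_right (l : ℤ) (l ^ z * G))
  have hs := fun κ (hκ : κ < α + J) => hurwitzPow_sub_of_lt hl hneg hκ hdisc
  simp only [hn] at hs
  -- the class numbers at level `γ`
  have htop : z = 0 → hurwitzPow l (t ^ 2 - 4 * q) (α + J + 1) = 0 := fun h0 => by
    rw [hdisc, hurwitzPow_add hl]
    refine hurwitzPow_eq_zero_of_not_sq_dvd hl hneg (dvd_mul_right _ _) (dvd_mul_right _ _) ?_ 0
    rw [pow_two, mul_dvd_mul_iff_left hl0.ne', h0, pow_zero, one_mul]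
    exact hG
  -- `classH` subtracts nothing at level γ, but T_(e+1) = 0 when e + 1 = γ, so T_(e+1) may be
  -- subtracted in every case.
  have hsub : (if α + J + 1 ≤ β ∧ α + J + 1 < γ then
      hurwitzPow l (t ^ 2 - 4 * q) (α + J + 1) else 0) =
      hurwitzPow l (t ^ 2 - 4 * q) (α + J + 1) := by
    by_cases h0 : z = 0
    · rw [htop h0, ite_self]
    · rw [if_pos ⟨by omega, by omega⟩]
  rw [hsub] at hC
  rw [rootSum]
  generalize hurwitzPow l (t ^ 2 - 4 * q) = T at *
  have hs' : ∀ κ ≤ α + J, T κ - T (κ + 1) = (l : ℚ) ^ (α + J - κ) * (T (α + J) - T (α + J + 1)) := by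
    intro κ hκ
    rcases Nat.lt_or_eq_of_le hκ with h | rfl
    · rw [hs κ h, show α + J - κ = (α + J - 1 - κ) + 1 by omega]; push_cast; ring
    · simp
  have hR : ∑ j ∈ range (β - α + 1), weight l (γ - α) j * C j =
      (J + 1) * (l : ℚ) ^ J * (T (α + J) - T (α + J + 1)) := by
    have h1 : ∑ j ∈ range (β - α + 1), weight l (γ - α) j * C j =
        ∑ j ∈ range (J + 1), weight l (γ - α) j * (T (α + j) - T (α + J + 1)) := by
      rw [show β - α + 1 = (J + 1) + (x + 1) by omega, sum_range_add, sum_eq_zero (s := range (x + 1)),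
        add_zero]
      · refine sum_congr rfl fun j hj => ?_
        have := mem_range.1 hj
        rw [hC j (by omega), if_pos (by omega)]
      · intro j hj
        have := mem_range.1 hj
        rw [hC _ (by omega), if_neg (by omega), mul_zero]
    rw [h1, sum_weight hl (by omega)]
    have h2 : ∀ i ∈ range J, (l : ℚ) ^ i * ((T (α + i) - T (α + J + 1)) -
        (T (α + (i + 1)) - T (α + J + 1))) = l ^ J * (T (α + J) - T (α + J + 1)) := by
      intro i hi
      have := mem_range.1 hi
      have h3 := hs' (α + i) (by omega)
      rw [show α + J - (α + i) = J - i by omega] at h3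
      have h4 : (l : ℚ) ^ J = l ^ i * l ^ (J - i) := by rw [← pow_add]; congr 1; omega
      rw [h4, ← add_assoc]
      linear_combination (l : ℚ) ^ i * h3
    rw [sum_congr rfl h2, sum_const, card_range, nsmul_eq_mul]
    ring
  have hαγ : α + γ = (J + 1) + (2 * α + z) := by omega
  have hL1 : ∀ κ ∈ range (J + 1), (l : ℚ) ^ κ * shiftCount l α γ t q b (α + γ + κ) *
      (T κ - T (κ + 1)) = l ^ (2 * α + J) * (T (α + J) - T (α + J + 1)) := fun κ hκ => by
    have := mem_range.1 hκ
    have h1 : (l : ℚ) ^ (2 * α + J) = l ^ κ * l ^ α * l ^ (α + J - κ) := by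
      rw [← pow_add, ← pow_add]; congr 1; omega
    rw [hW, if_pos (by omega), hs' κ (by omega), h1]
    push_cast; ring
  have hL2 : ∀ κ ∈ range (2 * α + z), (l : ℚ) ^ (J + 1 + κ) *
      shiftCount l α γ t q b (α + γ + (J + 1 + κ)) * (T (J + 1 + κ) - T (J + 1 + κ + 1)) = 0 :=
    fun κ _ => by rw [hW, if_neg (by omega)]; simp
  have hL : ∑ κ ∈ range (α + γ), (l : ℚ) ^ κ * shiftCount l α γ t q b (α + γ + κ) *
      (T κ - T (κ + 1)) = (J + 1) * (l ^ (2 * α + J) * (T (α + J) - T (α + J + 1))) := by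
    rw [show range (α + γ) = range ((J + 1) + (2 * α + z)) by rw [hαγ], sum_range_add,
      sum_congr rfl hL1, sum_eq_zero hL2, sum_const, card_range, nsmul_eq_mul]
    push_cast; ring
  rw [hR, hL, psi_ratio hl (by omega), hW, if_neg (by omega)]
  push_cast; ring

end BelowLevel

lemma pow_dvd_pow_mul_iff (hl : l.Prime) {n m : ℕ} {X : ℤ} :
    (l : ℤ) ^ n ∣ (l : ℤ) ^ m * X ↔ (l : ℤ) ^ (n - m) ∣ X := by
  have hl0 : (l : ℤ) ≠ 0 := by exact_mod_cast hl.ne_zero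
  rcases le_total n m with h | h
  · rw [Nat.sub_eq_zero_of_le h, pow_zero]
    exact iff_of_true ((pow_dvd_pow _ h).mul_right _) (one_dvd _)
  · obtain ⟨k, rfl⟩ := Nat.exists_eq_add_of_le h
    rw [pow_add, mul_dvd_mul_iff_left (pow_ne_zero _ hl0), Nat.add_sub_cancel_left]

section SimpleRoot

/-! The case in which `b² - t b + q` is divisible by `ℓ^(γ + β)` and `β < γ`. -/

variable {G V : ℤ}

/-- Dividing by ℓ^(γ+β) leaves a polynomial in y with unit linear coefficient V. The subtractions
are truncated: there is no condition on y while α + κ ≤ β. -/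
lemma shiftCount_of_simple (hl : l.Prime) (hβγ : β < γ)
    (hF : b ^ 2 - t * b + q = (l : ℤ) ^ (γ + β) * G)
    (hV : 2 * b - t = (l : ℤ) ^ β * V) (hlV : ¬ (l : ℤ) ∣ V) {κ : ℕ} (hκ : κ ≤ β) :
    shiftCount l α γ t q b (α + γ + κ) = l ^ (α - (α + κ - β)) := by
  obtain ⟨z, rfl⟩ : ∃ z, γ = β + z + 1 := ⟨γ - β - 1, by omega⟩
  have hexp : ∀ y : ℤ, (b ^ 2 - t * b + q) + (l : ℤ) ^ (β + z + 1) * (2 * b - t) * y +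
      l ^ (2 * (β + z + 1)) * y ^ 2 = l ^ (β + z + 1 + β) *
        (G + V * y + l ^ (z + 1) * y ^ 2) := fun y => by
    rw [hF, hV]; ring
  rw [← classCount_linear hl hlV (dvd_pow_self (l : ℤ) (by omega : z + 1 ≠ 0)) G
    (show α + κ - β ≤ α by omega), shiftCount]
  simp only [shift_expand, hexp, pow_dvd_pow_mul_iff hl]
  rw [show α + (β + z + 1) + κ - (β + z + 1 + β) = α + κ - β by omega]

/-- The first δ terms are ℓ^α; the remaining ones, ℓ^α down to ℓ, form a geometric sum. -/
lemma sum_pow_sub (l α δ : ℕ) : ((l : ℚ) - 1) *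
    ∑ κ ∈ range (α + δ), (l : ℚ) ^ (α - (α + κ - (α + δ))) + l =
      δ * (l - 1) * l ^ α + l ^ (α + 1) := by
  rw [add_comm α δ, sum_range_add]
  have h1 : ∀ κ ∈ range δ, (l : ℚ) ^ (α - (α + κ - (δ + α))) = l ^ α := fun κ hκ => by
    have := mem_range.1 hκ
    congr 1; omega
  have h2 : ∀ i ∈ range α, (l : ℚ) ^ (α - (α + (δ + i) - (δ + α))) = l ^ (α - 1 - i) * l := fun i hi => by
    have := mem_range.1 hi
    rw [← pow_succ]; congr 1; omega
  rw [sum_congr rfl h1, sum_congr rfl h2, sum_const, card_range, nsmul_eq_mul, ← sum_mul,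
    sum_range_reflect (fun i => (l : ℚ) ^ i)]
  have := geom_sum_mul (l : ℚ) α
  linear_combination (l : ℚ) * this

/-- The polynomial of discriminant Δ/ℓ^(2β) has two roots modulo ℓ. So T_κ = 0 for κ > β, and T_κ -
T_(κ+1) = ℓ^(β-1-κ) (ℓ - 1) T_β for κ < β. -/
lemma rootSum_of_simple (hl : l.Prime) (hαβ : α ≤ β) (hβγ : β < γ)
    (hΔ : t ^ 2 - 4 * (q : ℤ) < 0)
    (hF : b ^ 2 - t * b + q = (l : ℤ) ^ (γ + β) * G)
    (hV : 2 * b - t = (l : ℤ) ^ β * V) (hlV : ¬ (l : ℤ) ∣ V) (C : ℕ → ℚ)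
    (hC : ∀ j ≤ β - α, C j = hurwitzPow l (t ^ 2 - 4 * q) (α + j)) :
    rootSum l α γ t q b = psi (l ^ (2 * γ)) / psi (l ^ (2 * γ - 2 * α)) *
      ∑ j ∈ range (β - α + 1), weight l (γ - α) j * C j := by
  have hl0 : (0 : ℤ) < l := by exact_mod_cast hl.pos
  have hlq : (l : ℚ) ≠ 0 := by exact_mod_cast hl.ne_zero
  have hW := fun κ hκ => shiftCount_of_simple (α := α) (κ := κ) hl hβγ hF hV hlV hκ
  obtain ⟨z, hz⟩ : ∃ z, γ = β + 1 + z := ⟨γ - β - 1, by omega⟩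
  obtain ⟨δ, rfl⟩ : ∃ δ, β = α + δ := ⟨β - α, by omega⟩
  have hdisc : t ^ 2 - 4 * (q : ℤ) = l ^ (2 * (α + δ)) * (V ^ 2 - 4 * (l * (l ^ z * G))) := by
    have : t ^ 2 - 4 * (q : ℤ) = (2 * b - t) ^ 2 - 4 * (b ^ 2 - t * b + q) := by ring
    rw [this, hF, hV, hz]; ring
  have hneg : V ^ 2 - 4 * (l * (l ^ z * G)) < 0 := by
    rw [hdisc] at hΔ
    exact (pos_iff_neg_of_mul_neg hΔ).1 (by positivity)
  have hn : nroots l V (l * (l ^ z * G)) = 2 := by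
    rw [nroots_eq_quadCount]
    refine quadCount_eq_two hl (ρ := 0) ?_ (by simpa using hlV) 0
    simp
  have hs := fun κ (hκ : κ < α + δ) => hurwitzPow_sub_of_lt hl hneg hκ hdisc
  have htop : ∀ i, hurwitzPow l (t ^ 2 - 4 * q) (α + δ + 1 + i) = 0 := fun i => by
    rw [hdisc, add_assoc, hurwitzPow_add hl, add_comm 1 i]
    exact hurwitzPow_eq_zero_of_nroots_ne_one hl hneg (by omega) i
  simp only [hn] at hs
  rw [rootSum]
  generalize hurwitzPow l (t ^ 2 - 4 * q) = T at *
  have hs' : ∀ κ < α + δ, l * (T κ - T (κ + 1)) = (l : ℚ) ^ (α + δ - κ) * (l - 1) * T (α + δ) := by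
    intro κ hκ
    have h0 := htop 0
    rw [add_zero] at h0
    rw [hs κ hκ, h0, show α + δ - κ = (α + δ - 1 - κ) + 1 by omega]
    push_cast; ring
  have hR : l * ∑ j ∈ range (α + δ - α + 1), weight l (γ - α) j * C j =
      (δ * (l - 1) + l) * (l : ℚ) ^ δ * T (α + δ) := by
    rw [Nat.add_sub_cancel_left] at hC ⊢
    rw [sum_congr rfl (g := fun j => weight l (γ - α) j * T (α + j)) fun j hj => by
      rw [hC j (by have := mem_range.1 hj; omega)], sum_weight hl (by omega), mul_add, mul_sum]
    have h2 : ∀ i ∈ range δ, (l : ℚ) * (l ^ i * (T (α + i) - T (α + (i + 1)))) =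
        l ^ δ * (l - 1) * T (α + δ) := by
      intro i hi
      have := mem_range.1 hi
      have h3 := hs' (α + i) (by omega)
      rw [show α + δ - (α + i) = δ - i by omega] at h3
      have h4 : (l : ℚ) ^ δ = l ^ i * l ^ (δ - i) := by rw [← pow_add]; congr 1; omega
      rw [h4, ← add_assoc]
      linear_combination (l : ℚ) ^ i * h3
    rw [sum_congr rfl h2, sum_const, card_range, nsmul_eq_mul]
    ring
  have hL1 : ∀ κ ∈ range (α + δ), (l : ℚ) * (l ^ κ * shiftCount l α γ t q b (α + γ + κ) *
      (T κ - T (κ + 1))) =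
      l ^ (α - (α + κ - (α + δ))) * (l ^ (α + δ) * (l - 1) * T (α + δ)) := fun κ hκ => by
    have := mem_range.1 hκ
    have h1 : (l : ℚ) ^ (α + δ) = l ^ κ * l ^ (α + δ - κ) := by
      rw [← pow_add]; congr 1; omega
    rw [hW κ (by omega), h1]
    push_cast
    linear_combination (l : ℚ) ^ κ * l ^ (α - (α + κ - (α + δ))) * hs' κ this
  have hL2 : ∀ κ ∈ range (α + z), (l : ℚ) ^ (α + δ + 1 + κ) *
      shiftCount l α γ t q b (α + γ + (α + δ + 1 + κ)) *
        (T (α + δ + 1 + κ) - T (α + δ + 1 + κ + 1)) = 0 :=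
    fun κ _ => by rw [add_assoc (α + δ + 1) κ 1, htop, htop]; ring
  have hL : l * ∑ κ ∈ range (α + γ), (l : ℚ) ^ κ * shiftCount l α γ t q b (α + γ + κ) *
      (T κ - T (κ + 1)) = (δ * (l - 1) + l) * l ^ (2 * α + δ) * T (α + δ) := by
    rw [show range (α + γ) = range ((α + δ + 1) + (α + z)) by rw [hz]; congr 1; ring, sum_range_add,
      sum_eq_zero hL2, add_zero, sum_range_succ, mul_add, mul_sum, sum_congr rfl hL1, ← sum_mul,
      hW _ le_rfl, show α - (α + (α + δ) - (α + δ)) = 0 by omega]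
    have h0 := htop 0
    rw [add_zero] at h0
    rw [h0]
    have h1 := sum_pow_sub l α δ
    push_cast
    linear_combination (l : ℚ) ^ (α + δ) * T (α + δ) * h1
  have hT : T (α + γ) = 0 := by
    rw [show α + γ = α + δ + 1 + (α + z) by omega]; exact htop _
  -- The extra factor ℓ in `hL` and `hR` avoids the exponent β - 1 - κ.
  apply mul_left_cancel₀ hlq
  rw [psi_ratio hl (by omega), hT, mul_zero, add_zero, hL, mul_left_comm, hR]
  ring

end SimpleRoot

section TopLevel

/-! The case in which `b² - t b + q` is divisible by `ℓ^(2 γ)` and `2 b - t` by `ℓ^γ`. -/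

variable {u w : ℤ}

lemma shiftCount_of_top (hl : l.Prime) (hF : b ^ 2 - t * b + q = (l : ℤ) ^ (2 * γ) * w)
    (hV : 2 * b - t = (l : ℤ) ^ γ * u) (κ : ℕ) :
    shiftCount l α γ t q b (α + γ + κ) = quadCount l u w α (α + κ - γ) := by
  have hexp : ∀ y : ℤ, (b ^ 2 - t * b + q) + (l : ℤ) ^ γ * (2 * b - t) * y +
      l ^ (2 * γ) * y ^ 2 = l ^ (2 * γ) * (y ^ 2 + u * y + w) := fun y => by
    rw [hF, hV]; ring
  rw [shiftCount, quadCount]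
  simp only [shift_expand, hexp, pow_dvd_pow_mul_iff hl]
  rw [show α + γ + κ - 2 * γ = α + κ - γ by omega]

/-- Here m = α - 1 and g = γ - α. For κ ≤ g every y counts; g < κ < γ and γ ≤ κ < α + γ give the two
sums of `LocalIdentity`, and the last term of `rootSum` gives its third. -/
lemma rootSum_of_top_pos (hl : l.Prime) {m g : ℕ} (hγ : γ = m + 1 + g)
    (hΔ : t ^ 2 - 4 * (q : ℤ) < 0) (hF : b ^ 2 - t * b + q = (l : ℤ) ^ (2 * γ) * w)
    (hV : 2 * b - t = (l : ℤ) ^ γ * u) :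
    rootSum l (m + 1) γ t q b = (l : ℚ) ^ (γ + m) * (g * (l + 1 - nroots l u w) *
      (hurwitzPow l (t ^ 2 - 4 * q) γ - hurwitzPow l (t ^ 2 - 4 * q) (γ + 1)) +
        (l + 1) * hurwitzPow l (t ^ 2 - 4 * q) γ) := by
  have hl0 : (0 : ℤ) < l := by exact_mod_cast hl.pos
  have hW := fun κ => shiftCount_of_top (α := m + 1) hl hF hV κ
  have hdisc : t ^ 2 - 4 * (q : ℤ) = l ^ (2 * γ) * (u ^ 2 - 4 * w) := by
    have : t ^ 2 - 4 * (q : ℤ) = (2 * b - t) ^ 2 - 4 * (b ^ 2 - t * b + q) := by ring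
    rw [this, hF, hV]; ring
  have hneg : u ^ 2 - 4 * w < 0 := by
    rw [hdisc] at hΔ
    exact (pos_iff_neg_of_mul_neg hΔ).1 (by positivity)
  have hs := fun κ (hκ : κ < γ) => hurwitzPow_sub_of_lt hl hneg hκ hdisc
  have hT' : ∀ i, hurwitzPow l (u ^ 2 - 4 * w) i = hurwitzPow l (t ^ 2 - 4 * q) (γ + i) := fun i => by
    rw [hdisc, hurwitzPow_add hl]
  have hloc := localIdentity hl hneg m
  rw [LocalIdentity] at hloc
  simp only [hT', add_zero] at hloc
  rw [rootSum]
  generalize hurwitzPow l (t ^ 2 - 4 * q) = T at *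
  set s := (l + 1 - nroots l u w : ℚ) * (T γ - T (γ + 1)) with hsdef
  have hs' : ∀ κ < γ, T κ - T (κ + 1) = (l : ℚ) ^ (γ - 1 - κ) * s := fun κ hκ => by
    rw [hs κ hκ, mul_assoc]
  have hA : ∀ κ ∈ range (g + 1), (l : ℚ) ^ κ * shiftCount l (m + 1) γ t q b (m + 1 + γ + κ) *
      (T κ - T (κ + 1)) = l ^ (γ + m) * s := fun κ hκ => by
    have := mem_range.1 hκ
    rw [hW, show m + 1 + κ - γ = 0 by omega, quadCount_zero, hs' κ (by omega),
      show (l : ℚ) ^ (γ + m) = l ^ κ * l ^ (m + 1) * l ^ (γ - 1 - κ) by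
        rw [← pow_add, ← pow_add]; congr 1; omega]
    push_cast; ring
  have hB : ∀ i ∈ range m, (l : ℚ) ^ (g + 1 + i) *
      shiftCount l (m + 1) γ t q b (m + 1 + γ + (g + 1 + i)) *
        (T (g + 1 + i) - T (g + 1 + i + 1)) = (l : ℚ) ^ γ * s *
          (l ^ (m - 1 - i) * quadCount l u w (m - (m - 1 - i)) (m - (m - 1 - i))) := fun i hi => by
    have := mem_range.1 hi
    have h1 : quadCount l u w (m + 1) (i + 1) = l ^ (m - i) * quadCount l u w (i + 1) (i + 1) := by
      rw [← quadCount_add hl, show i + 1 + (m - i) = m + 1 by omega]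
    rw [hW, show m + 1 + (g + 1 + i) - γ = i + 1 by omega, h1, hs' _ (by omega),
      show m - (m - 1 - i) = i + 1 by omega, show γ - 1 - (g + 1 + i) = m - 1 - i by omega,
      show (l : ℚ) ^ γ = l ^ (g + 1 + i) * l ^ (m - i) by rw [← pow_add]; congr 1; omega]
    push_cast; ring
  have hC : ∀ i ∈ range (m + 1), (l : ℚ) ^ (γ + i) *
      shiftCount l (m + 1) γ t q b (m + 1 + γ + (γ + i)) *
        (T (γ + i) - T (γ + i + 1)) = (l : ℚ) ^ γ *
          ((T (γ + i) - T (γ + (i + 1))) * l ^ i * quadCount l u w (m + 1) (m + 1 + i)) := fun i _ => by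
    rw [hW, show m + 1 + (γ + i) - γ = m + 1 + i by omega, ← add_assoc γ i 1]
    ring
  have hsum : ∑ κ ∈ range (m + 1 + γ), (l : ℚ) ^ κ *
      shiftCount l (m + 1) γ t q b (m + 1 + γ + κ) * (T κ - T (κ + 1)) =
      (g + 1) * (l ^ (γ + m) * s) + (l : ℚ) ^ γ * s *
        ∑ i ∈ range m, (l : ℚ) ^ i * quadCount l u w (m - i) (m - i) +
      (l : ℚ) ^ γ * ∑ i ∈ range (m + 1), (T (γ + i) - T (γ + (i + 1))) * l ^ i *
        quadCount l u w (m + 1) (m + 1 + i) := by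
    rw [show range (m + 1 + γ) = range (γ + (m + 1)) by rw [add_comm], sum_range_add,
      sum_congr rfl hC, ← mul_sum, show range γ = range (g + 1 + m) by rw [hγ]; congr 1; ring,
      sum_range_add, sum_congr rfl hA, sum_congr rfl hB, ← mul_sum (range m),
      sum_range_reflect (fun i => (l : ℚ) ^ i * quadCount l u w (m - i) (m - i)), sum_const,
      card_range, nsmul_eq_mul]
    push_cast; ring
  rw [hsum, hW, show m + 1 + (m + 1 + γ) - γ = 2 * m + 2 by omega, add_right_comm m 1 γ,
    psi_prime_pow_succ hl, show m + γ + 1 = γ + (m + 1) by ring]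
  linear_combination (l : ℚ) ^ γ * hloc

lemma rootSum_of_top_zero (hl : l.Prime)
    (hF : b ^ 2 - t * b + q = (l : ℤ) ^ (2 * γ) * w) (hV : 2 * b - t = (l : ℤ) ^ γ * u) :
    rootSum l 0 γ t q b = ∑ κ ∈ range γ, (l : ℚ) ^ κ *
      (hurwitzPow l (t ^ 2 - 4 * q) κ - hurwitzPow l (t ^ 2 - 4 * q) (κ + 1)) +
        psi (l ^ γ) * hurwitzPow l (t ^ 2 - 4 * q) γ := by
  have hW : ∀ κ ≤ γ, shiftCount l 0 γ t q b (γ + κ) = 1 := fun κ hκ => by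
    have := shiftCount_of_top (α := 0) hl hF hV κ
    rw [zero_add, zero_add, Nat.sub_eq_zero_of_le hκ, quadCount_zero, pow_zero] at this
    exact this
  rw [rootSum, zero_add, hW γ le_rfl]
  rw [sum_congr rfl fun κ hκ => by rw [hW κ (mem_range.1 hκ).le]]
  simp

/-- The weights now run to their exceptional last value. The case α = 0 needs no local identity, and
α = γ is separate because the denominator is ψ(1). -/
lemma rootSum_of_top (hl : l.Prime) (hαγ : α ≤ γ) (hΔ : t ^ 2 - 4 * (q : ℤ) < 0)
    (hF : b ^ 2 - t * b + q = (l : ℤ) ^ (2 * γ) * w) (hV : 2 * b - t = (l : ℤ) ^ γ * u) (C : ℕ → ℚ)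
    (hC : ∀ j ≤ γ - α, C j = hurwitzPow l (t ^ 2 - 4 * q) (α + j)) :
    rootSum l α γ t q b = psi (l ^ (2 * γ)) / psi (l ^ (2 * γ - 2 * α)) *
      ∑ j ∈ range (γ - α + 1), weight l (γ - α) j * C j := by
  have hl0 : (0 : ℤ) < l := by exact_mod_cast hl.pos
  have hCs : ∑ j ∈ range (γ - α + 1), weight l (γ - α) j * C j =
      ∑ j ∈ range (γ - α + 1), weight l (γ - α) j * hurwitzPow l (t ^ 2 - 4 * q) (α + j) :=
    sum_congr rfl fun j hj => by rw [hC j (by have := mem_range.1 hj; omega)]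
  rw [hCs]
  obtain ⟨g, rfl⟩ : ∃ g, γ = α + g := ⟨γ - α, by omega⟩
  rw [Nat.add_sub_cancel_left]
  rcases α with _ | m
  · rw [rootSum_of_top_zero hl hF hV]
    simp only [zero_add, mul_zero, Nat.sub_zero]
    have hne : psi (l ^ (2 * g)) ≠ 0 := by
      rcases g with _ | g
      · rw [mul_zero, pow_zero, psi_one]; exact one_ne_zero
      · have : (l : ℚ) ≠ 0 := by exact_mod_cast hl.ne_zero
        rw [show 2 * (g + 1) = 2 * g + 1 + 1 by ring, psi_prime_pow_succ hl]
        positivity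
    rw [div_self hne, one_mul]
    rcases g with _ | g
    · simp [weight_zero hl, psi_one]
    · rw [sum_weight_top hl, psi_prime_pow_succ hl]; ring
  · rw [rootSum_of_top_pos hl rfl hΔ hF hV]
    have hdisc : t ^ 2 - 4 * (q : ℤ) = l ^ (2 * (m + 1 + g)) * (u ^ 2 - 4 * w) := by
      have : t ^ 2 - 4 * (q : ℤ) = (2 * b - t) ^ 2 - 4 * (b ^ 2 - t * b + q) := by ring
      rw [this, hF, hV]; ring
    have hneg : u ^ 2 - 4 * w < 0 := by
      rw [hdisc] at hΔ
      exact (pos_iff_neg_of_mul_neg hΔ).1 (by positivity)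
    have hs := fun κ (hκ : κ < m + 1 + g) => hurwitzPow_sub_of_lt hl hneg hκ hdisc
    generalize hurwitzPow l (t ^ 2 - 4 * q) = T at *
    rcases g with _ | g
    · rw [show 2 * (m + 1 + 0) - 2 * (m + 1) = 0 by omega, pow_zero, psi_one,
        show 2 * (m + 1 + 0) = (2 * m + 1) + 1 by ring, psi_prime_pow_succ hl]
      simp only [zero_add, sum_range_one, weight_zero hl, add_zero]
      push_cast; ring
    · rw [psi_ratio hl (by omega), sum_weight_top hl]
      have h2 : ∀ i ∈ range (g + 1), (l : ℚ) ^ i * (T (m + 1 + i) - T (m + 1 + (i + 1))) =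
          l ^ g * ((l + 1 - nroots l u w) * (T (m + 1 + (g + 1)) - T (m + 1 + (g + 1) + 1))) := by
        intro i hi
        have := mem_range.1 hi
        have h3 := hs (m + 1 + i) (by omega)
        rw [show m + 1 + (g + 1) - 1 - (m + 1 + i) = g - i by omega] at h3
        have h4 : (l : ℚ) ^ g = l ^ i * l ^ (g - i) := by rw [← pow_add]; congr 1; omega
        rw [h4, ← add_assoc (m + 1) i 1, h3]
        ring
      rw [sum_congr rfl h2, sum_const, card_range, nsmul_eq_mul]
      push_cast; ring

end TopLevel

/-- The value e = β + 1 records divisibility at every tested exponent. -/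
lemma exists_level (l β γ : ℕ) (F : ℤ) :
    ∃ e ≤ β + 1, ∀ i ≤ β, (l : ℤ) ^ (γ + i) ∣ F ↔ i < e := by
  classical
  have hex : ∃ k, k = β + 1 ∨ ¬ (l : ℤ) ^ (γ + k) ∣ F := ⟨β + 1, Or.inl rfl⟩
  refine ⟨Nat.find hex, Nat.find_min' hex (Or.inl rfl), fun i hi => ⟨fun hE => ?_, fun hlt => ?_⟩⟩
  · by_contra hge
    rcases Nat.find_spec hex with h | h
    · omega
    · exact h ((pow_dvd_pow _ (by omega)).trans hE)
  · have := Nat.find_min hex hlt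
    push Not at this
    exact this.2

end EllipticTerm

/-! ### Assembly of the cases. -/

theorem proposition4p3 (l : ℕ) (hl : l.Prime) (q : ℕ) (hq : ¬ l ∣ q)
    (α β γ : ℕ) (hαβ : α ≤ β) (hβγ : β ≤ γ) (d : (ZMod (l ^ γ))ˣ)
    (hd : Nat.gcd ((d : ZMod (l ^ γ)) ^ 2 * (q : ZMod (l ^ γ)) - 1).val (l ^ γ) = l ^ β)
    (t : ℤ) (ht : t ^ 2 < 4 * (q : ℤ)) :
    EllipticTerm.ellipticC l α γ t q d =
      2 * (EllipticTerm.psi (l ^ (2 * γ)) / EllipticTerm.psi (l ^ (2 * γ - 2 * α))) *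
        ∑ j ∈ Finset.range (β - α + 1),
          ((Nat.totient (l ^ (2 * j)) : ℚ) * (Nat.totient (l ^ (γ - α - j)) : ℚ) /
              (Nat.totient (l ^ (γ - α)) : ℚ)) *
            EllipticTerm.classH l γ (α + j) t q d := by
  open EllipticTerm in
  classical
  have hΔ : t ^ 2 - 4 * (q : ℤ) < 0 := by linarith
  obtain ⟨a, b, ha, hab⟩ := exists_lift_inverse hl d
  have h := isLift_of_gcd hl hβγ hd ha hab
  have hlhs : ellipticC l α γ t q d = rootSum l α γ t q b :=
    ellipticC_eq hl hq (intCast_eq_inv ha hab) t hΔ.ne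
  have hrhs : 2 * (psi (l ^ (2 * γ)) / psi (l ^ (2 * γ - 2 * α))) *
      ∑ j ∈ Finset.range (β - α + 1),
        ((Nat.totient (l ^ (2 * j)) : ℚ) * (Nat.totient (l ^ (γ - α - j)) : ℚ) /
          (Nat.totient (l ^ (γ - α)) : ℚ)) * classH l γ (α + j) t q d =
      psi (l ^ (2 * γ)) / psi (l ^ (2 * γ - 2 * α)) *
        ∑ j ∈ Finset.range (β - α + 1), weight l (γ - α) j * (2 * classH l γ (α + j) t q d) := by
    rw [mul_comm 2, mul_assoc, Finset.mul_sum]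
    congr 1
    exact Finset.sum_congr rfl fun j _ => by rw [weight]; ring
  rw [hlhs, hrhs]
  obtain ⟨e, heβ, he⟩ := exists_level l β γ (b ^ 2 - t * b + q)
  have hH := fun j (hj : j ≤ β - α) => classH_eq (f := α + j) hl h ha t (by omega) he
  rcases Nat.lt_or_ge α e with hαe | hαe
  swap
  · rw [rootSum_eq_zero h hαβ (by rw [he α hαβ]; omega), Finset.sum_eq_zero, mul_zero]
    intro j hj
    rw [hH j (by have := Finset.mem_range.1 hj; omega), if_neg (by omega), mul_zero]
  -- From here on e is the last exponent with ℓ^(γ+e) ∣ F(b), capped at β.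
  obtain ⟨e, rfl⟩ : ∃ e', e = e' + 1 := ⟨e - 1, by omega⟩
  have hE : (l : ℤ) ^ (γ + e) ∣ b ^ 2 - t * b + q := (he e (by omega)).2 (by omega)
  have hFγ : (l : ℤ) ^ γ ∣ b ^ 2 - t * b + q := (pow_dvd_pow _ (by omega)).trans hE
  obtain ⟨V, hV⟩ := h.dvd_deriv hFγ
  obtain ⟨G, hG⟩ := hE
  rcases Nat.lt_or_ge e β with h1 | h1
  · refine rootSum_of_lt hl (by omega) h1 hβγ hΔ hG ?_ hV _ hH
    rintro ⟨G', rfl⟩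
    have := (he (e + 1) h1).1 ⟨G', by rw [hG]; ring⟩
    omega
  · obtain rfl : e = β := by omega
    have hH' : ∀ j ≤ e - α, 2 * classH l γ (α + j) t q d = hurwitzPow l (t ^ 2 - 4 * q) (α + j) :=
      fun j hj => by rw [hH j hj, if_pos (by omega), if_neg (by omega), sub_zero]
    rcases Nat.lt_or_eq_of_le hβγ with h2 | rfl
    · refine rootSum_of_simple hl hαβ h2 hΔ hG hV ?_ _ hH'
      rintro ⟨V', rfl⟩
      -- b² - q = b F'(b) - F(b), so ℓ ∣ V would contradict that b² - q has valuation exactly β < γ.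
      have h3 : (l : ℤ) ^ (e + 1) ∣ b ^ 2 - q :=
        dvd_of_eq_right (dvd_sub (dvd_mul_right ((l : ℤ) ^ (e + 1)) (b * V'))
          ((pow_dvd_pow (l : ℤ) h2).trans hFγ)) (by linear_combination (-b) * hV)
      have := (h.dvd_iff (e + 1) h2).1 h3
      omega
    · exact rootSum_of_top (w := G) hl hαβ hΔ (by rw [hG]; ring) hV _ hH'
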